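/- **Setting.** Let $\Lambda$ be a finite set of sites, the vertices of a lattice graph, with graph distance $d$. Each site $x$ carries a finite-dimensional Hilbert space $\mathcal H_x$ and a linear unitary representation $g\mapsto u_x(g)$ of an Abelian group $G$; a region is a set $X\subseteq\Lambda$, with Hilbert space $\mathcal H_X=\bigotimes_{x\in X}\mathcal H_x$ and representation $u_X=\bigotimes_{x\in X}u_x$. For a character $\kappa:G\to U(1)$ (a charge), let $\Pi^{(X)}_\kappa$ be the orthogonal projector onto $\{v\in\mathcal H_X: u_X(g)v=\kappa(g)v\ \forall g\in G\}$. A *symmetric circuit* is a product $V=\prod_{k=1}^{n}U_k$ in which each layer $U_k$ is a product of unitaries (gates) that act on pairwise disjoint regions $X$ and commute with $u_X(g)$ for all $g\in G$. Its range is bounded by $R$ if the depth $n$ times the maximal diameter of the supports of the gates is at most $R$. A state on $\mathcal H_\Lambda$ is a *product state* if it is of the form $\bigotimes_{x\in\Lambda}\sigma_x$ with (possibly mixed) one-site states $\sigma_x$. Let $A,B\subseteq\Lambda$ be non-overlapping regions and let $C$ be a region disjoint from $A\cup B$ that is surrounded by $A$, $B$ and the boundaries of the system, i.e. every lattice neighbour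 of a site of $C$ lies in $A\cup B\cup C$. For a state $\rho$ on $\mathcal H_\Lambda$ put $$\Omega^{(AB|C)}(\rho)=\sum_\kappa |\kappa\rangle\langle\kappa|^{(K_C)}\otimes \operatorname{tr}_{\overline{AB}}\bigl(\Pi^{(C)}_\kappa\,\rho\bigr),$$ where the sum is over the charges that occur in $C$ (those with $\Pi^{(C)}_\kappa\neq0$), the vectors $|\kappa\rangle$ form an orthonormal basis of the register $K_C$, and the trace is over all sites outside $A\cup B$. Call a real-valued function $E$ of bipartite states (on all finite-dimensional bipartite systems) an *entanglement measure* if it is non-negative, does not increase under local operations and classical communication (LOCC), and vanishes on product states. **Theorem.** Suppose that there is a symmetric circuit $V$ with range bounded by $R$ such that $V\rho V^\dagger$ is a product state. If $\operatorname{dist}(A,B)=\min_{a\in A,\,b\in B}d(a,b)>4R$, then the state $\Omega^{(AB|C)}(\rho)$ is separable with respect to the bipartition $AK_C\,|\,B$, and also with respect to $A\,|\,K_CB$. Hence $E\bigl(\Omega^{(AB|C)}(\rho)\bigr)=0$ for every entanglement measure $E$, relative to either bipartition; that is, the SPT-entanglement of $\rho$ between $A$ and $B$ relative to $C$ is zero.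 -/

import Mathlib

open Matrix
open scoped Kronecker ComplexOrder

universe u

namespace SPT

/-! ### States, separability, entanglement measures -/

/-- Density matrices: positive semidefinite matrices of trace one. -/
def IsState {n : Type u} [Fintype n] (ρ : Matrix n n ℂ) : Prop :=
  ρ.PosSemidef ∧ ρ.trace = 1

/-- Separability of a bipartite state: a finite convex combination of tensor products of states. -/
def IsSeparable {m n : Type u} [Fintype m] [Fintype n] (ω : Matrix (m × n) (m × n) ℂ) : Prop :=
  ∃ (k : ℕ) (p : Fin k → ℝ) (σ : Fin k → Matrix m m ℂ) (τ : Fin k → Matrix n n ℂ),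
    (∀ i, 0 ≤ p i) ∧ ∑ i, p i = 1 ∧ (∀ i, IsState (σ i)) ∧ (∀ i, IsState (τ i)) ∧
    ω = ∑ i, (p i : ℂ) • (σ i ⊗ₖ τ i)

/-- `ω` is turned into `ω'` by one round of LOCC with communication from left to right: the left
party applies the instrument with Kraus operators `K i` and announces the outcome `i`, upon which
the right party applies the channel with Kraus operators `L i j`. The local spaces may change. -/
def LOCCLeftToRight {m n m' n' : Type u} [Fintype m] [Fintype n] [DecidableEq m] [DecidableEq n]
    [Fintype m'] [Fintype n']
    (ω : Matrix (m × n) (m × n) ℂ) (ω' : Matrix (m' × n') (m' × n') ℂ) : Prop :=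
  ∃ (k l : ℕ) (K : Fin k → Matrix m' m ℂ) (L : Fin k → Fin l → Matrix n' n ℂ),
    ∑ i, (K i)ᴴ * K i = 1 ∧ (∀ i, ∑ j, (L i j)ᴴ * L i j = 1) ∧
    ω' = ∑ i, ∑ j, (K i ⊗ₖ L i j) * ω * (K i ⊗ₖ L i j)ᴴ

/-- One round of LOCC with communication from right to left. -/
def LOCCRightToLeft {m n m' n' : Type u} [Fintype m] [Fintype n] [DecidableEq m] [DecidableEq n]
    [Fintype m'] [Fintype n']
    (ω : Matrix (m × n) (m × n) ℂ) (ω' : Matrix (m' × n') (m' × n') ℂ) : Prop :=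
  ∃ (k l : ℕ) (K : Fin k → Fin l → Matrix m' m ℂ) (L : Fin k → Matrix n' n ℂ),
    ∑ i, (L i)ᴴ * L i = 1 ∧ (∀ i, ∑ j, (K i j)ᴴ * K i j = 1) ∧
    ω' = ∑ i, ∑ j, (K i j ⊗ₖ L i) * ω * (K i j ⊗ₖ L i)ᴴ

/-- Measures of (bipartite) entanglement: non-negative functions of the states of all
finite-dimensional bipartite systems which do not increase under LOCC and vanish on product states.
Since the Kraus operators may write outcomes into local registers, every LOCC protocol is
a finite sequence of one-round steps, so monotonicity is required for those steps. -/
structure EntanglementMeasure where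
  /-- The value on an operator of the bipartite system with local bases `m` and `n`. -/
  value : ∀ (m n : Type u) [Fintype m] [Fintype n], Matrix (m × n) (m × n) ℂ → ℝ
  nonneg : ∀ (m n : Type u) [Fintype m] [Fintype n] (ω : Matrix (m × n) (m × n) ℂ),
    IsState ω → 0 ≤ value m n ω
  le_of_leftToRight : ∀ (m n m' n' : Type u) [Fintype m] [Fintype n] [DecidableEq m]
    [DecidableEq n] [Fintype m'] [Fintype n'] (ω : Matrix (m × n) (m × n) ℂ)
    (ω' : Matrix (m' × n') (m' × n') ℂ), IsState ω → LOCCLeftToRight ω ω' →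
    value m' n' ω' ≤ value m n ω
  le_of_rightToLeft : ∀ (m n m' n' : Type u) [Fintype m] [Fintype n] [DecidableEq m]
    [DecidableEq n] [Fintype m'] [Fintype n'] (ω : Matrix (m × n) (m × n) ℂ)
    (ω' : Matrix (m' × n') (m' × n') ℂ), IsState ω → LOCCRightToLeft ω ω' →
    value m' n' ω' ≤ value m n ω
  product : ∀ (m n : Type u) [Fintype m] [Fintype n] (σ : Matrix m m ℂ) (τ : Matrix n n ℂ),
    IsState σ → IsState τ → value m n (σ ⊗ₖ τ) = 0

/-! ### Lattice systems -/

section Lattice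

variable {Λ : Type u} [Fintype Λ] [DecidableEq Λ] (S : Λ → Type u) [∀ x, Fintype (S x)]
  [∀ x, DecidableEq (S x)]

/-- Basis configurations of a region `X`; the site `x` has the Hilbert space `ℂ^(S x)`. -/
abbrev Conf (X : Finset Λ) : Type u := ∀ x : X, S x

/-- Operators on the Hilbert space of the whole system. -/
abbrev Op : Type u := Matrix (∀ x, S x) (∀ x, S x) ℂ

variable {S}

/-- The restriction of a configuration of the system to a region. -/
def res (X : Finset Λ) (s : ∀ x, S x) : Conf S X := fun x => s x

/-- An operator of the region `X`, tensored with the identity on all other sites. -/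
def localOp (X : Finset Λ) (M : Matrix (Conf S X) (Conf S X) ℂ) : Op S :=
  Matrix.of fun s t => if ∀ x, x ∉ X → s x = t x then M (res X s) (res X t) else 0

/-- The partial trace over all sites outside `A` and `B`, as an operator on the tensor product of
the Hilbert spaces of the disjoint regions `A` and `B`. -/
noncomputable def traceOutside (A B : Finset Λ) (M : Op S) :
    Matrix (Conf S A × Conf S B) (Conf S A × Conf S B) ℂ :=
  Matrix.of fun i j => ∑ s : ∀ x, S x, ∑ t : ∀ x, S x,
    if res A s = i.1 ∧ res B s = i.2 ∧ res A t = j.1 ∧ res B t = j.2 ∧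
      ∀ x, x ∉ A → x ∉ B → s x = t x then M s t else 0

/-- Product states: tensor products over all sites of one-site states. -/
def IsProductState (σ : Op S) : Prop :=
  ∃ τ : ∀ x, Matrix (S x) (S x) ℂ, (∀ x, IsState (τ x)) ∧
    σ = Matrix.of fun s t => ∏ x, τ x (s x) (t x)

/-! ### On-site symmetry and charges -/

variable {G : Type u} [CommGroup G] (φ : ∀ x, G →* Matrix.unitaryGroup (S x) ℂ)

/-- The representation of `G` on the region `X`, the tensor product of the on-site ones. -/
def regionRep (X : Finset Λ) (g : G) : Matrix (Conf S X) (Conf S X) ℂ :=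
  Matrix.of fun s t => ∏ x : X, (φ x g : Matrix (S x) (S x) ℂ) (s x) (t x)

/-- The subspace of vectors of charge `κ` in the region `X`. -/
noncomputable def chargeSector (X : Finset Λ) (κ : G →* Circle) :
    Submodule ℂ (EuclideanSpace ℂ (Conf S X)) :=
  ⨅ g : G, Module.End.eigenspace (Matrix.toEuclideanLin (regionRep φ X g)) (κ g : ℂ)

/-- The orthogonal projector onto the subspace of charge `κ` in the region `X`. -/
noncomputable def chargeProj (X : Finset Λ) (κ : G →* Circle) :
    Matrix (Conf S X) (Conf S X) ℂ :=
  (Matrix.toEuclideanCLM (n := Conf S X) (𝕜 := ℂ)).symm (chargeSector φ X κ).starProjection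

/-- The charges that occur in the region `X`; they label the basis of its charge register. All
other charges have projector zero. -/
abbrev RegionCharge (X : Finset Λ) : Type u :=
  {κ : G →* Circle // chargeSector φ X κ ≠ ⊥}

set_option linter.unusedSectionVars false in
lemma regionRep_star_mul (X : Finset Λ) (g : G) :
    (regionRep φ X g)ᴴ * regionRep φ X g = 1 := by
  ext s t
  have h : ∀ x : X, ∑ a, star ((φ x g : Matrix (S x) (S x) ℂ) a (s x)) *
      (φ x g : Matrix (S x) (S x) ℂ) a (t x) = if s x = t x then 1 else 0 := by
    intro x
    have h1 := congrFun (congrFun (Matrix.mem_unitaryGroup_iff'.1 (φ x g).2) (s x)) (t x)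
    simpa [Matrix.mul_apply, Matrix.star_apply, Matrix.one_apply] using h1
  simp only [Matrix.mul_apply, Matrix.conjTranspose_apply, regionRep, Matrix.of_apply, star_prod,
    ← Finset.prod_mul_distrib]
  rw [← Fintype.prod_sum (fun (x : X) a => star ((φ x g : Matrix (S x) (S x) ℂ) a (s x)) *
      (φ x g : Matrix (S x) (S x) ℂ) a (t x)), Finset.prod_congr rfl fun x _ => h x]
  by_cases hst : s = t
  · subst hst; simp
  · obtain ⟨x, hx⟩ := Function.ne_iff.1 hst
    rw [Matrix.one_apply_ne hst]
    exact Finset.prod_eq_zero (Finset.mem_univ x) (if_neg hx)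

lemma orthogonalFamily_chargeSector (X : Finset Λ) :
    OrthogonalFamily ℂ (fun κ => chargeSector φ X κ) fun κ => (chargeSector φ X κ).subtypeₗᵢ := by
  intro κ κ' hne v w
  obtain ⟨g, hg⟩ : ∃ g, κ g ≠ κ' g := by
    by_contra! h
    exact hne (MonoidHom.ext h)
  have hv : Matrix.toEuclideanLin (regionRep φ X g) v = (κ g : ℂ) • (v : EuclideanSpace ℂ _) :=
    Module.End.mem_eigenspace_iff.1 ((Submodule.mem_iInf _).1 v.2 g)
  have hw : Matrix.toEuclideanLin (regionRep φ X g) w = (κ' g : ℂ) • (w : EuclideanSpace ℂ _) :=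
    Module.End.mem_eigenspace_iff.1 ((Submodule.mem_iInf _).1 w.2 g)
  have hu : inner ℂ (Matrix.toEuclideanLin (regionRep φ X g) v)
      (Matrix.toEuclideanLin (regionRep φ X g) w) =
      inner ℂ (v : EuclideanSpace ℂ (Conf S X)) (w : EuclideanSpace ℂ (Conf S X)) := by
    rw [← LinearMap.adjoint_inner_right, ← Matrix.toEuclideanLin_conjTranspose_eq_adjoint]
    congr 1
    ext i
    simp [Matrix.toEuclideanLin, Matrix.mulVec_mulVec, regionRep_star_mul]
  rw [hv, hw, inner_smul_left, inner_smul_right, ← mul_assoc] at hu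
  change inner ℂ (v : EuclideanSpace ℂ (Conf S X)) (w : EuclideanSpace ℂ (Conf S X)) = 0
  by_contra h0
  have h1 : (starRingEnd ℂ) (κ g : ℂ) * (κ' g : ℂ) = 1 := mul_right_cancel₀ h0 (by rw [hu, one_mul])
  rw [← Circle.coe_inv_eq_conj, ← Circle.coe_mul] at h1
  have h2 : (κ g)⁻¹ * κ' g = 1 := Circle.ext (by simpa using h1)
  exact hg (inv_mul_eq_one.1 h2)

instance finite_regionCharge (X : Finset Λ) : Finite (RegionCharge φ X) :=
  (WellFoundedGT.finite_ne_bot_of_iSupIndep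
    (orthogonalFamily_chargeSector φ X).independent).to_subtype

noncomputable instance fintypeRegionCharge (X : Finset Λ) : Fintype (RegionCharge φ X) :=
  Fintype.ofFinite _

open Classical in
/-- The state `∑_κ |κ⟩⟨κ| ⊗ tr_{outside A ∪ B} (Π_κ^(C) ρ)` of the charge register `K_C` and of the
regions `A` and `B`, written with respect to the bipartition `A K_C | B`. -/
noncomputable def Omega (A B C : Finset Λ) (ρ : Op S) :
    Matrix ((RegionCharge φ C × Conf S A) × Conf S B)
      ((RegionCharge φ C × Conf S A) × Conf S B) ℂ :=
  Matrix.of fun i j => if i.1.1 = j.1.1 then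
    traceOutside A B (localOp C (chargeProj φ C i.1.1) * ρ) (i.1.2, i.2) (j.1.2, j.2) else 0

/-- The same state, written with respect to the bipartition `A | K_C B`. -/
noncomputable def Omega' (A B C : Finset Λ) (ρ : Op S) :
    Matrix (Conf S A × (RegionCharge φ C × Conf S B))
      (Conf S A × (RegionCharge φ C × Conf S B)) ℂ :=
  (Omega φ A B C ρ).submatrix (fun i => ((i.2.1, i.1), i.2.2)) (fun i => ((i.2.1, i.1), i.2.2))

/-! ### Symmetric circuits -/

/-- A symmetric gate: a unitary of some region that commutes with the symmetry. -/
structure SymmetricGate where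
  /-- The region on which the gate acts. -/
  support : Finset Λ
  /-- The unitary of that region. -/
  op : Matrix (Conf S support) (Conf S support) ℂ
  unitary : op ∈ Matrix.unitaryGroup (Conf S support) ℂ
  symmetric : ∀ g : G, op * regionRep φ support g = regionRep φ support g * op

/-- A layer of a circuit: finitely many symmetric gates acting on non-overlapping regions. -/
structure SymmetricLayer where
  /-- The gates of the layer. -/
  gates : List (SymmetricGate φ)
  disjoint : gates.Pairwise fun a b => Disjoint a.support b.support

variable {φ}

/-- The unitary of the whole system implemented by a layer. -/
def SymmetricLayer.toOp (U : SymmetricLayer φ) : Op S :=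
  (U.gates.map fun a => localOp a.support a.op).prod

/-- The unitary implemented by a circuit, the product of its layers. -/
def circuitOp (V : List (SymmetricLayer φ)) : Op S :=
  (V.map SymmetricLayer.toOp).prod

/-- The range of the circuit is bounded by `R`: its depth times the maximal range of its gates is at
most `R`, where the range of a gate is the diameter of its support in the lattice graph `L`. -/
def CircuitRangeLE (L : SimpleGraph Λ) (V : List (SymmetricLayer φ)) (R : ℕ) : Prop :=
  ∃ r : ℕ, (∀ U ∈ V, ∀ a ∈ U.gates, ∀ x ∈ a.support, ∀ y ∈ a.support, L.edist x y ≤ r) ∧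
    V.length * r ≤ R

/-- The distance of two regions in the lattice graph `L` (infinite if one of them is empty). -/
noncomputable def regionDist (L : SimpleGraph Λ) (A B : Finset Λ) : ℕ∞ :=
  ⨅ a ∈ A, ⨅ b ∈ B, L.edist a b

/-- The region `C` is surrounded by `A`, `B` and the boundaries of the system: it is disjoint from
`A` and `B`, and every lattice neighbour of a site of `C` lies in `A`, `B` or `C`. -/
def IsSurrounded (L : SimpleGraph Λ) (A B C : Finset Λ) : Prop :=
  Disjoint C A ∧ Disjoint C B ∧ ∀ x ∈ C, ∀ y, L.Adj x y → y ∈ A ∪ B ∪ C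

end Lattice

end SPT

/-!
Measuring the charge of `C` cannot create entanglement between `A` and `B`, for the following
reason. Let `D` be the neighbourhood of `A` of radius `2 R`, and let `W` be the circuit `V` without
the gates which connect `D` with its complement. The operator `T = V† W` is a product of operators
`K† Z† K`, where `Z` is a layer of removed gates and `K` the part of `W` acting before it. By the
light cone bound each removed gate contributes a symmetric operator supported within distance `R`
of it (`isLocal_conj_circuit`). Such a support avoids `A` and `B`, and since every path leaving `C`
meets `A` or `B`, the condition `dist(A, B) > 4 R` forces it to lie inside of `C` or outside of `C`
(`nbhd_of_crossing`). In the second case it trivially commutes with the symmetry `u_C(g)`, in the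
first case it does so because it commutes with `u_Λ(g)`. Hence `T` commutes with the observables of
`A` and of `B` and with the charge projectors of `C`, so that `ρ` may be replaced by
`ρ' = T† ρ T = W† (V ρ V†) W` (`exists_uncorrelated_state`), and this state has no correlations
between `D` and its complement, because the cut circuit `W` factorizes.

The charge of `C` is the product of the charges of `C ∩ D` and `C \ D` (`chargeOp_union`).
Therefore `Ω` is the sum over all pairs of charges `κ₁`, `κ₂` of
`|κ₁ κ₂⟩⟨κ₁ κ₂| ⊗ X_κ₁ ⊗ Y_κ₂` (`Omega_apply_eq_sum`), where the positive operator `X_κ₁` on `A` is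
the partial trace of `Π_κ₁ ρ'`, and similarly for `B`. The register is classical, so it may be given
to either party. Finally, a separable state can be prepared from a product state by one round of
LOCC, so every entanglement measure vanishes on it (`EntanglementMeasure.value_eq_zero`).
-/

namespace SPT

set_option linter.unusedSectionVars false

/-! ### Local operators -/

section LocalOperators

variable {Λ : Type u} [Fintype Λ] [DecidableEq Λ] {S : Λ → Type u} [∀ x, Fintype (S x)]
  [∀ x, DecidableEq (S x)]

/-- Splitting a configuration of the system into configurations of a region and its complement. -/
def splitEquiv (X : Finset Λ) : (∀ x, S x) ≃ Conf S X × Conf S Xᶜ where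
  toFun s := (res X s, res Xᶜ s)
  invFun c x := if h : x ∈ X then c.1 ⟨x, h⟩ else c.2 ⟨x, Finset.mem_compl.2 h⟩
  left_inv s := by
    ext x
    by_cases h : x ∈ X <;> simp [h, res]
  right_inv c := by
    refine Prod.ext (funext fun x => ?_) (funext fun x => ?_)
    · simp [res]
    · have := Finset.mem_compl.1 x.2
      simp [res, this]

lemma localOp_apply (X : Finset Λ) (M : Matrix (Conf S X) (Conf S X) ℂ) (s t : ∀ x, S x) :
    localOp X M s t = if ∀ x, x ∉ X → s x = t x then M (res X s) (res X t) else 0 := rfl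

/-- The entries of `M ⊗ N ⊗ 1`, which do not depend on the order of the two factors. -/
lemma localOp_mul_localOp_apply {X Y : Finset Λ} (h : Disjoint X Y)
    (M : Matrix (Conf S X) (Conf S X) ℂ) (N : Matrix (Conf S Y) (Conf S Y) ℂ) (s t : ∀ x, S x) :
    (localOp X M * localOp Y N) s t = if ∀ x, x ∉ X → x ∉ Y → s x = t x then
      M (res X s) (res X t) * N (res Y s) (res Y t) else 0 := by
  -- only the intermediate configuration equal to `t` on `X` and to `s` elsewhere contributes
  let w : ∀ x, S x := fun x => if x ∈ X then t x else s x
  have hwX : res X w = res X t := funext fun x => by simp [res, w]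
  have hwY : res Y w = res Y s := funext fun x => by
    have : (x : Λ) ∉ X := fun hx => Finset.disjoint_left.1 h hx x.2
    simp [res, w, this]
  rw [Matrix.mul_apply, Finset.sum_eq_single w]
  · have h1 : ∀ x, x ∉ X → s x = w x := fun x hx => by simp [w, hx]
    have h2 : (∀ x, x ∉ Y → w x = t x) ↔ ∀ x, x ∉ X → x ∉ Y → s x = t x := by
      refine ⟨fun H x hX hY => by simpa [w, hX] using H x hY, fun H x hY => ?_⟩
      by_cases hX : x ∈ X
      · simp [w, hX]
      · simpa [w, hX] using H x hX hY
    rw [localOp_apply, localOp_apply, if_pos h1, hwX, hwY]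
    simp only [h2, mul_ite, mul_zero]
  · intro v _ hv
    rw [localOp_apply, localOp_apply]
    split_ifs with h1 h2
    · refine absurd (funext fun x => ?_) hv
      by_cases hX : x ∈ X
      · simp [w, hX, h2 x (Finset.disjoint_left.1 h hX)]
      · simp [w, hX, h1 x hX]
    all_goals simp
  · simp

lemma localOp_commute {X Y : Finset Λ} (h : Disjoint X Y)
    (M : Matrix (Conf S X) (Conf S X) ℂ) (N : Matrix (Conf S Y) (Conf S Y) ℂ) :
    Commute (localOp X M) (localOp Y N) := by
  ext s t
  rw [localOp_mul_localOp_apply h, localOp_mul_localOp_apply h.symm]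
  have : (∀ x, x ∉ X → x ∉ Y → s x = t x) ↔ ∀ x, x ∉ Y → x ∉ X → s x = t x :=
    ⟨fun H x a b => H x b a, fun H x a b => H x b a⟩
  simp only [this, mul_comm]

lemma localOp_one (X : Finset Λ) : localOp X (1 : Matrix (Conf S X) (Conf S X) ℂ) = 1 := by
  ext s t
  rw [localOp_apply, Matrix.one_apply, Matrix.one_apply, ← ite_and]
  congr 1
  refine propext ⟨fun ⟨h1, h2⟩ => funext fun x => ?_, fun h => by simp [h]⟩
  by_cases hx : x ∈ X
  · exact congrFun h2 ⟨x, hx⟩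
  · exact h1 x hx

lemma localOp_mul (X : Finset Λ) (M N : Matrix (Conf S X) (Conf S X) ℂ) :
    localOp X (M * N) = localOp X M * localOp X N := by
  ext s t
  rw [localOp_apply, Matrix.mul_apply, Matrix.mul_apply]
  have key : ∀ f : (∀ x, S x) → ℂ, (∀ v, ¬ (∀ x, x ∉ X → s x = v x) → f v = 0) →
      ∑ v, f v = ∑ c : Conf S X, f (fun x => if h : x ∈ X then c ⟨x, h⟩ else s x) := by
    intro f hf
    symm
    refine Finset.sum_of_injOn (fun c x => if h : x ∈ X then c ⟨x, h⟩ else s x) ?_ (by simp) ?_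
      (fun _ _ => rfl)
    · intro c _ d _ hcd
      funext x
      simpa [x.2] using congrFun hcd x
    · intro v _ hv
      refine hf v fun H => hv ⟨res X v, by simp, funext fun x => ?_⟩
      by_cases hx : x ∈ X
      · simp [hx, res]
      · simp [hx, H x hx]
  rw [key]
  · have h1 : ∀ c : Conf S X, res X (fun x => if h : x ∈ X then c ⟨x, h⟩ else s x) = c :=
      fun c => funext fun x => by simp [res]
    have h2 : ∀ c : Conf S X, ∀ x, x ∉ X → s x = if h : x ∈ X then c ⟨x, h⟩ else s x :=
      fun c x hx => by simp [hx]
    have h3 : ∀ c : Conf S X, (∀ x, x ∉ X → (if h : x ∈ X then c ⟨x, h⟩ else s x) = t x) ↔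
        ∀ x, x ∉ X → s x = t x := fun c =>
      forall_congr' fun x => imp_congr_right fun hx => by simp [hx]
    simp only [localOp_apply, h1, h3]
    split_ifs with h
    · exact Finset.sum_congr rfl fun c _ => by rw [if_pos (h2 c)]
    · simp
  · intro v hv
    rw [localOp_apply, if_neg hv, zero_mul]

lemma localOp_conjTranspose (X : Finset Λ) (M : Matrix (Conf S X) (Conf S X) ℂ) :
    localOp X Mᴴ = (localOp X M)ᴴ := by
  ext s t
  simp only [Matrix.conjTranspose_apply, localOp_apply, apply_ite star, star_zero,
    fun x => eq_comm (a := s x) (b := t x)]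

lemma localOp_smul (X : Finset Λ) (c : ℂ) (M : Matrix (Conf S X) (Conf S X) ℂ) :
    localOp X (c • M) = c • localOp X M := by
  ext s t
  simp [localOp_apply]

lemma localOp_sum {ι : Type*} (I : Finset ι) (X : Finset Λ)
    (M : ι → Matrix (Conf S X) (Conf S X) ℂ) :
    localOp X (∑ i ∈ I, M i) = ∑ i ∈ I, localOp X (M i) := by
  ext s t
  simp only [localOp_apply, Matrix.sum_apply]
  split_ifs <;> simp

/-- An operator on a subregion, regarded as an operator on a larger region. -/
lemma localOp_mono {X Y : Finset Λ} (h : X ⊆ Y) (M : Matrix (Conf S X) (Conf S X) ℂ) :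
    ∃ N : Matrix (Conf S Y) (Conf S Y) ℂ, localOp Y N = localOp X M := by
  refine ⟨Matrix.of fun s t => if ∀ x : Y, (x : Λ) ∉ X → s x = t x then
    M (fun x => s ⟨x, h x.2⟩) (fun x => t ⟨x, h x.2⟩) else 0, ?_⟩
  ext s t
  simp only [localOp_apply, Matrix.of_apply, ← ite_and]
  congr 1
  refine propext ⟨fun ⟨h1, h2⟩ x hx => ?_, fun H => ⟨fun x hx => H x fun h' => hx (h h'),
    fun x hx => H x hx⟩⟩
  by_cases hY : x ∈ Y
  · exact h2 ⟨x, hY⟩ hx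
  · exact h1 x hY

lemma trace_localOp_mul_localOp_compl (X : Finset Λ) (M : Matrix (Conf S X) (Conf S X) ℂ)
    (N : Matrix (Conf S Xᶜ) (Conf S Xᶜ) ℂ) :
    (localOp X M * localOp Xᶜ N).trace = M.trace * N.trace := by
  have h : Disjoint X Xᶜ := disjoint_compl_right
  simp only [Matrix.trace, Matrix.diag_apply, localOp_mul_localOp_apply h,
    implies_true, if_true, Fintype.sum_mul_sum, ← Fintype.sum_prod_type']
  exact Fintype.sum_equiv (splitEquiv X) _ _ fun s => rfl

/-- The partial trace is dual to the inclusion of the operators on `A` and `B`: its matrix entries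
are the expectation values of products of matrix units. -/
lemma traceOutside_apply {A B : Finset Λ} (h : Disjoint A B) (M : Op S)
    (i j : Conf S A × Conf S B) :
    traceOutside A B M i j =
      (localOp A (single j.1 i.1 1) * localOp B (single j.2 i.2 1) * M).trace := by
  simp only [Matrix.trace, Matrix.diag_apply, Matrix.mul_apply (N := M), traceOutside,
    Matrix.of_apply, localOp_mul_localOp_apply h, Matrix.single_apply]
  rw [Finset.sum_comm]
  refine Finset.sum_congr rfl fun t _ => Finset.sum_congr rfl fun s _ => ?_
  by_cases h1 : ∀ x, x ∉ A → x ∉ B → t x = s x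
  · have h2 : ∀ x, x ∉ A → x ∉ B → s x = t x := fun x a b => (h1 x a b).symm
    rw [if_pos h1]
    by_cases a : res A s = i.1 <;> by_cases b : res B s = i.2 <;> by_cases c : res A t = j.1 <;>
      by_cases d : res B t = j.2 <;> simp [a, b, c, d, eq_comm]
    all_goals grind
  · have h2 : ¬ ∀ x, x ∉ A → x ∉ B → s x = t x := fun H => h1 fun x a b => (H x a b).symm
    rw [if_neg h1, if_neg (by tauto), zero_mul]

/-- The operator `T` acts as the identity outside the region `X`. -/
def IsLocal (X : Finset Λ) (T : Op S) : Prop := ∃ M, localOp X M = T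

lemma isLocal_localOp (X : Finset Λ) (M : Matrix (Conf S X) (Conf S X) ℂ) :
    IsLocal X (localOp X M) := ⟨M, rfl⟩

lemma IsLocal.mul {X : Finset Λ} {T T' : Op S} (h : IsLocal X T) (h' : IsLocal X T') :
    IsLocal X (T * T') := by
  obtain ⟨M, rfl⟩ := h
  obtain ⟨N, rfl⟩ := h'
  exact ⟨M * N, localOp_mul X M N⟩

lemma IsLocal.conjTranspose {X : Finset Λ} {T : Op S} (h : IsLocal X T) : IsLocal X Tᴴ := by
  obtain ⟨M, rfl⟩ := h
  exact ⟨Mᴴ, localOp_conjTranspose X M⟩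

lemma IsLocal.mono {X Y : Finset Λ} {T : Op S} (hXY : X ⊆ Y) (h : IsLocal X T) : IsLocal Y T := by
  obtain ⟨M, rfl⟩ := h
  exact localOp_mono hXY M

lemma IsLocal.commute {X Y : Finset Λ} {T T' : Op S} (hXY : Disjoint X Y) (h : IsLocal X T)
    (h' : IsLocal Y T') : Commute T T' := by
  obtain ⟨M, rfl⟩ := h
  obtain ⟨N, rfl⟩ := h'
  exact localOp_commute hXY M N

lemma isLocal_one (X : Finset Λ) : IsLocal X (1 : Op S) := ⟨1, localOp_one X⟩

/-- In a product state, observables of a region and of its complement are uncorrelated. -/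
lemma IsProductState.trace_mul {σ : Op S} (hσ : IsProductState σ) {X : Finset Λ} {F H : Op S}
    (hF : IsLocal X F) (hH : IsLocal Xᶜ H) :
    (F * H * σ).trace = (F * σ).trace * (H * σ).trace := by
  obtain ⟨τ, hτ, rfl⟩ := hσ
  obtain ⟨M, rfl⟩ := hF
  obtain ⟨N, rfl⟩ := hH
  let p : ∀ Y : Finset Λ, Matrix (Conf S Y) (Conf S Y) ℂ := fun Y =>
    Matrix.of fun s t => ∏ x : Y, τ x (s x) (t x)
  have hp : (Matrix.of fun s t : ∀ x, S x => ∏ x, τ x (s x) (t x)) =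
      localOp X (p X) * localOp Xᶜ (p Xᶜ) := by
    ext s t
    have h0 : ∀ x, x ∉ X → x ∉ Xᶜ → s x = t x := fun x h h' => by simp [h] at h'
    rw [localOp_mul_localOp_apply disjoint_compl_right, if_pos h0]
    simp only [p, Matrix.of_apply, res]
    rw [Finset.prod_coe_sort X fun x => τ x (s x) (t x),
      Finset.prod_coe_sort Xᶜ fun x => τ x (s x) (t x), Finset.prod_mul_prod_compl]
  have htr : ∀ Y, (p Y).trace = 1 := by
    intro Y
    simp only [Matrix.trace, Matrix.diag_apply, p, Matrix.of_apply]
    rw [← Fintype.prod_sum (fun (x : Y) a => τ x a a)]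
    exact Finset.prod_eq_one fun x _ => (hτ x).2
  have hc : Commute (localOp Xᶜ N) (localOp X (p X)) := localOp_commute disjoint_compl_left _ _
  have h1 : localOp X M * localOp Xᶜ N * (localOp X (p X) * localOp Xᶜ (p Xᶜ)) =
      localOp X (M * p X) * localOp Xᶜ (N * p Xᶜ) := by
    rw [localOp_mul, localOp_mul, mul_assoc, ← mul_assoc (localOp Xᶜ N), hc.eq]
    simp only [mul_assoc]
  have h2 : localOp Xᶜ N * (localOp X (p X) * localOp Xᶜ (p Xᶜ)) =
      localOp X (p X) * localOp Xᶜ (N * p Xᶜ) := by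
    rw [localOp_mul, ← mul_assoc, hc.eq, mul_assoc]
  rw [hp, h1, h2, ← mul_assoc, ← localOp_mul]
  simp [trace_localOp_mul_localOp_compl, htr]

end LocalOperators

/-! ### Charge sectors -/

section Charges

/-- A family of commuting unitaries is simultaneously diagonalizable. -/
lemma iSup_iInf_eigenspace_eq_top {n G : Type*} [Fintype n] [DecidableEq n]
    (u : G → Matrix n n ℂ) (hu : ∀ g, (u g)ᴴ * u g = 1) (hc : ∀ g h, Commute (u g) (u h)) :
    ⨆ χ : G → ℂ, ⨅ g, Module.End.eigenspace (Matrix.toEuclideanLin (u g)) (χ g) = ⊤ := by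
  have hcomm : ∀ g h, Commute (Matrix.toEuclideanLin (u g)) (Matrix.toEuclideanLin (u h)) := by
    intro g h
    refine LinearMap.ext fun v => WithLp.ofLp_injective 2 ?_
    change u g *ᵥ (u h *ᵥ v.ofLp) = u h *ᵥ (u g *ᵥ v.ofLp)
    rw [Matrix.mulVec_mulVec, (hc g h).eq, Matrix.mulVec_mulVec]
  have hinner : ∀ g (v w : EuclideanSpace ℂ n),
      inner ℂ (Matrix.toEuclideanLin (u g) v) (Matrix.toEuclideanLin (u g) w) = inner ℂ v w := by
    intro g v w
    rw [← LinearMap.adjoint_inner_right, ← Matrix.toEuclideanLin_conjTranspose_eq_adjoint]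
    congr 1
    ext i
    simp [Matrix.toEuclideanLin, Matrix.mulVec_mulVec, hu]
  -- the orthogonal complement of an invariant subspace of a unitary is invariant
  have hss : ∀ g, Module.End.IsSemisimple (Matrix.toEuclideanLin (u g)) := by
    intro g
    rw [Module.End.isSemisimple_iff]
    intro p hp
    refine ⟨pᗮ, fun v hv => ?_, Submodule.isCompl_orthogonal _⟩
    have hinj : Function.Injective (Matrix.toEuclideanLin (u g)) := by
      refine (injective_iff_map_eq_zero _).2 fun v hv => ?_
      have := hinner g v v
      rw [hv, inner_zero_left] at this
      exact inner_self_eq_zero.1 this.symm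
    have hmap : p.map (Matrix.toEuclideanLin (u g)) = p :=
      Submodule.eq_of_le_of_finrank_eq (Submodule.map_le_iff_le_comap.2 hp)
        (Submodule.equivMapOfInjective _ hinj p).finrank_eq.symm
    refine (Submodule.mem_orthogonal _ _).2 fun w hw => ?_
    rw [← hmap] at hw
    obtain ⟨w', hw', rfl⟩ := hw
    rw [hinner]
    exact (Submodule.mem_orthogonal _ _).1 hv w' hw'
  have h := Module.End.iSup_iInf_maxGenEigenspace_eq_top_of_iSup_maxGenEigenspace_eq_top_of_commute
    (fun g => Matrix.toEuclideanLin (u g)) (fun g h _ => hcomm g h)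
    fun g => Module.End.iSup_maxGenEigenspace_eq_top _
  simpa only [fun g μ => (Module.End.isFinitelySemisimple_iff_isSemisimple.2
    (hss g)).maxGenEigenspace_eq_eigenspace μ] using h

variable {Λ : Type u} [Fintype Λ] [DecidableEq Λ] {S : Λ → Type u} [∀ x, Fintype (S x)]
  [∀ x, DecidableEq (S x)] {G : Type u} [CommGroup G]
  (φ : ∀ x, G →* Matrix.unitaryGroup (S x) ℂ)

lemma regionRep_mul (X : Finset Λ) (g h : G) :
    regionRep φ X (g * h) = regionRep φ X g * regionRep φ X h := by
  ext s t
  simp only [Matrix.mul_apply, regionRep, Matrix.of_apply, ← Finset.prod_mul_distrib, map_mul,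
    Submonoid.coe_mul]
  rw [← Fintype.prod_sum (fun (x : X) a => (φ x g : Matrix (S x) (S x) ℂ) (s x) a *
      (φ x h : Matrix (S x) (S x) ℂ) a (t x))]

lemma regionRep_one (X : Finset Λ) : regionRep φ X 1 = 1 := by
  have h := regionRep_star_mul φ X 1
  have h2 := regionRep_mul φ X 1 1
  rw [mul_one] at h2
  calc regionRep φ X 1 = (regionRep φ X 1)ᴴ * regionRep φ X 1 * regionRep φ X 1 := by
        rw [h, one_mul]
    _ = 1 := by rw [mul_assoc, ← h2, h]

/-- The Hilbert space of a region is the sum of its charge sectors. -/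
lemma iSup_chargeSector (X : Finset Λ) : ⨆ κ : RegionCharge φ X, chargeSector φ X κ.1 = ⊤ := by
  rw [eq_top_iff, ← iSup_iInf_eigenspace_eq_top (regionRep φ X) (regionRep_star_mul φ X)
    fun g h => by rw [Commute, SemiconjBy, ← regionRep_mul, ← regionRep_mul, mul_comm]]
  refine iSup_le fun χ => ?_
  by_cases hbot : ⨅ g, Module.End.eigenspace (Matrix.toEuclideanLin (regionRep φ X g)) (χ g) = ⊥
  · rw [hbot]; exact bot_le
  obtain ⟨v, hv, hv0⟩ := Submodule.exists_mem_ne_zero_of_ne_bot hbot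
  have hv' : ∀ g, Matrix.toEuclideanLin (regionRep φ X g) v = χ g • v := fun g =>
    Module.End.mem_eigenspace_iff.1 ((Submodule.mem_iInf _).1 hv g)
  have hone : χ 1 = 1 := by
    have := hv' 1
    rw [regionRep_one, Matrix.toLpLin_one, LinearMap.id_apply] at this
    exact smul_left_injective ℂ hv0 (by simpa using this.symm)
  have hmul : ∀ g h, χ (g * h) = χ g * χ h := by
    intro g h
    have h1 : Matrix.toEuclideanLin (regionRep φ X (g * h)) v = (χ g * χ h) • v := by
      have : Matrix.toEuclideanLin (regionRep φ X (g * h)) v =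
          Matrix.toEuclideanLin (regionRep φ X g) (Matrix.toEuclideanLin (regionRep φ X h) v) := by
        simp [Matrix.toEuclideanLin, regionRep_mul]
      rw [this, hv', map_smul, hv', smul_smul, mul_comm]
    exact smul_left_injective ℂ hv0 (by simpa using (hv' _).symm.trans h1)
  have hnorm : ∀ g, ‖χ g‖ = 1 := by
    intro g
    have h1 : inner ℂ (Matrix.toEuclideanLin (regionRep φ X g) v)
        (Matrix.toEuclideanLin (regionRep φ X g) v) = inner ℂ v v := by
      rw [← LinearMap.adjoint_inner_right, ← Matrix.toEuclideanLin_conjTranspose_eq_adjoint]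
      congr 1
      ext i
      simp [Matrix.toEuclideanLin, Matrix.mulVec_mulVec, regionRep_star_mul]
    have h2 : ‖χ g • v‖ = ‖v‖ := by
      rw [← hv', @norm_eq_sqrt_re_inner ℂ, h1, ← @norm_eq_sqrt_re_inner ℂ]
    rw [norm_smul] at h2
    exact mul_right_cancel₀ (norm_ne_zero_iff.2 hv0) (by rw [h2, one_mul])
  let κ : G →* Circle :=
    { toFun := fun g => ⟨χ g, mem_sphere_zero_iff_norm.2 (hnorm g)⟩
      map_one' := Circle.ext hone
      map_mul' := fun g h => Circle.ext (hmul g h) }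
  exact le_iSup (fun κ : RegionCharge φ X => chargeSector φ X κ.1) ⟨κ, hbot⟩

lemma toEuclideanCLM_chargeProj (X : Finset Λ) (κ : G →* Circle) :
    Matrix.toEuclideanCLM (n := Conf S X) (𝕜 := ℂ) (chargeProj φ X κ) =
      (chargeSector φ X κ).starProjection := by
  simp [chargeProj]

lemma chargeProj_conjTranspose (X : Finset Λ) (κ : G →* Circle) :
    (chargeProj φ X κ)ᴴ = chargeProj φ X κ := by
  apply EquivLike.injective (Matrix.toEuclideanCLM (n := Conf S X) (𝕜 := ℂ))
  rw [← Matrix.star_eq_conjTranspose, map_star, toEuclideanCLM_chargeProj]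
  exact isStarProjection_starProjection.isSelfAdjoint

lemma chargeProj_mul_self (X : Finset Λ) (κ : G →* Circle) :
    chargeProj φ X κ * chargeProj φ X κ = chargeProj φ X κ := by
  apply EquivLike.injective (Matrix.toEuclideanCLM (n := Conf S X) (𝕜 := ℂ))
  rw [map_mul, toEuclideanCLM_chargeProj]
  exact isStarProjection_starProjection.isIdempotentElem

lemma regionRep_mul_chargeProj (X : Finset Λ) (κ : G →* Circle) (g : G) :
    regionRep φ X g * chargeProj φ X κ = (κ g : ℂ) • chargeProj φ X κ := by
  apply EquivLike.injective (Matrix.toEuclideanCLM (n := Conf S X) (𝕜 := ℂ))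
  rw [map_mul, map_smul, toEuclideanCLM_chargeProj]
  refine ContinuousLinearMap.ext fun v => ?_
  have h := Submodule.starProjection_apply_mem (chargeSector φ X κ) v
  exact Module.End.mem_eigenspace_iff.1 ((Submodule.mem_iInf _).1 h g)

lemma sum_chargeProj (X : Finset Λ) : ∑ κ : RegionCharge φ X, chargeProj φ X κ.1 = 1 := by
  apply EquivLike.injective (Matrix.toEuclideanCLM (n := Conf S X) (𝕜 := ℂ))
  rw [map_sum, map_one]
  refine ContinuousLinearMap.ext fun v => ?_
  simp only [toEuclideanCLM_chargeProj, _root_.sum_apply]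
  exact ((orthogonalFamily_chargeSector φ X).comp
    Subtype.val_injective).sum_projection_of_mem_iSup v (by
      rw [iSup_chargeSector φ X]; trivial)

/-- The action `u_X(g)` of the symmetry on the region `X`, as an operator of the whole system. -/
def symOp (X : Finset Λ) (g : G) : Op S := localOp X (regionRep φ X g)

/-- The projector `Π_κ` of the region `X`, as an operator of the whole system. -/
noncomputable def chargeOp (X : Finset Λ) (κ : G →* Circle) : Op S := localOp X (chargeProj φ X κ)

lemma isLocal_symOp (X : Finset Λ) (g : G) : IsLocal X (symOp φ X g) := ⟨_, rfl⟩

lemma isLocal_chargeOp (X : Finset Λ) (κ : G →* Circle) : IsLocal X (chargeOp φ X κ) := ⟨_, rfl⟩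

lemma symOp_mul_symOp_of_disjoint {X Y : Finset Λ} (h : Disjoint X Y) (g : G) :
    symOp φ X g * symOp φ Y g = symOp φ (X ∪ Y) g := by
  ext s t
  rw [symOp, symOp, symOp, localOp_mul_localOp_apply h, localOp_apply]
  simp only [Finset.mem_union, not_or, and_imp, regionRep, Matrix.of_apply, res]
  rw [Finset.prod_coe_sort X fun x => (φ x g : Matrix (S x) (S x) ℂ) (s x) (t x),
    Finset.prod_coe_sort Y fun x => (φ x g : Matrix (S x) (S x) ℂ) (s x) (t x),
    Finset.prod_coe_sort (X ∪ Y) fun x => (φ x g : Matrix (S x) (S x) ℂ) (s x) (t x),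
    Finset.prod_union h]

lemma symOp_conjTranspose_mul (X : Finset Λ) (g : G) :
    (symOp φ X g)ᴴ * symOp φ X g = 1 := by
  rw [symOp, ← localOp_conjTranspose, ← localOp_mul, regionRep_star_mul, localOp_one]

lemma symOp_mul_conjTranspose (X : Finset Λ) (g : G) :
    symOp φ X g * (symOp φ X g)ᴴ = 1 :=
  mul_eq_one_comm.1 (symOp_conjTranspose_mul φ X g)

lemma chargeOp_conjTranspose (X : Finset Λ) (κ : G →* Circle) :
    (chargeOp φ X κ)ᴴ = chargeOp φ X κ := by
  rw [chargeOp, ← localOp_conjTranspose, chargeProj_conjTranspose]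

lemma chargeOp_mul_self (X : Finset Λ) (κ : G →* Circle) :
    chargeOp φ X κ * chargeOp φ X κ = chargeOp φ X κ := by
  rw [chargeOp, ← localOp_mul, chargeProj_mul_self]

lemma symOp_mul_chargeOp (X : Finset Λ) (κ : G →* Circle) (g : G) :
    symOp φ X g * chargeOp φ X κ = (κ g : ℂ) • chargeOp φ X κ := by
  rw [chargeOp, symOp, ← localOp_mul, regionRep_mul_chargeProj, localOp_smul]

lemma sum_chargeOp (X : Finset Λ) : ∑ κ : RegionCharge φ X, chargeOp φ X κ.1 = 1 := by
  simp only [chargeOp]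
  rw [← localOp_sum, sum_chargeProj, localOp_one]

lemma chargeOp_mul_symOp (X : Finset Λ) (κ : G →* Circle) (g : G) :
    chargeOp φ X κ * symOp φ X g = (κ g : ℂ) • chargeOp φ X κ := by
  have h : (symOp φ X g)ᴴ * chargeOp φ X κ = star (κ g : ℂ) • chargeOp φ X κ := by
    have h1 : (κ g : ℂ) • ((symOp φ X g)ᴴ * chargeOp φ X κ) = chargeOp φ X κ := by
      rw [← mul_smul_comm, ← symOp_mul_chargeOp, ← mul_assoc, symOp_conjTranspose_mul, one_mul]
    have h2 : star (κ g : ℂ) * (κ g : ℂ) = 1 := by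
      rw [mul_comm]
      simp [Complex.mul_conj]
    conv_rhs => rw [← h1, smul_smul, h2, one_smul]
  have := congrArg Matrix.conjTranspose h
  simpa [Matrix.conjTranspose_mul, chargeOp_conjTranspose, Matrix.conjTranspose_smul] using this

/-- An operator mapping into states of charge `κ'` is annihilated by `Π_κ` for `κ ≠ κ'`. -/
lemma chargeOp_mul_eq_zero {X : Finset Λ} {κ κ' : G →* Circle} (h : κ ≠ κ') {M : Op S}
    (hM : ∀ g, symOp φ X g * M = (κ' g : ℂ) • M) : chargeOp φ X κ * M = 0 := by
  obtain ⟨g, hg⟩ : ∃ g, κ g ≠ κ' g := by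
    by_contra! h'
    exact h (MonoidHom.ext h')
  have h1 : (κ g : ℂ) • (chargeOp φ X κ * M) = (κ' g : ℂ) • (chargeOp φ X κ * M) := by
    rw [← smul_mul_assoc, ← chargeOp_mul_symOp, mul_assoc, hM, mul_smul_comm]
  rw [← sub_eq_zero, ← sub_smul] at h1
  refine (smul_eq_zero.1 h1).resolve_left fun h2 => hg (Circle.ext (sub_eq_zero.1 h2))

lemma chargeOp_mul_eq_self {X : Finset Λ} {κ : G →* Circle} {M : Op S}
    (hM : ∀ g, symOp φ X g * M = (κ g : ℂ) • M) : chargeOp φ X κ * M = M := by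
  have h := congrArg (· * M) (sum_chargeOp φ X)
  simp only [Finset.sum_mul, one_mul] at h
  by_cases hκ : chargeSector φ X κ = ⊥
  · -- a charge that does not occur: all terms vanish, hence so does `M`
    rw [Finset.sum_eq_zero fun κ' _ => chargeOp_mul_eq_zero φ
      (fun e : κ'.1 = κ => κ'.2 (e ▸ hκ)) hM] at h
    rw [← h, mul_zero]
  · rwa [Finset.sum_eq_single ⟨κ, hκ⟩ (fun κ' _ hne => chargeOp_mul_eq_zero φ
      (fun e : κ'.1 = κ => hne (Subtype.ext e)) hM) (by simp)] at h

/-- What commutes with the symmetry of a region commutes with its charge projectors. -/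
lemma commute_chargeOp {X : Finset Λ} {T : Op S} (hT : ∀ g, Commute T (symOp φ X g))
    (κ : RegionCharge φ X) : Commute T (chargeOp φ X κ.1) := by
  have h1 : ∀ κ' : G →* Circle, ∀ g,
      symOp φ X g * (T * chargeOp φ X κ') = (κ' g : ℂ) • (T * chargeOp φ X κ') := by
    intro κ' g
    rw [← mul_assoc, ← (hT g).eq, mul_assoc, symOp_mul_chargeOp, mul_smul_comm]
  calc T * chargeOp φ X κ.1 = chargeOp φ X κ.1 * (T * chargeOp φ X κ.1) :=
        (chargeOp_mul_eq_self φ (h1 κ.1)).symm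
    _ = ∑ κ' : RegionCharge φ X, chargeOp φ X κ.1 * (T * chargeOp φ X κ'.1) :=
        (Finset.sum_eq_single κ (fun κ' _ hne => chargeOp_mul_eq_zero φ
          (fun e => hne (Subtype.ext e.symm)) (h1 κ'.1)) (by simp)).symm
    _ = chargeOp φ X κ.1 * T := by
        rw [← Finset.mul_sum, ← Finset.mul_sum, sum_chargeOp, mul_one]

open Classical in
/-- Fusion of charges: the charge of a union of two disjoint regions is the product of theirs. -/
lemma chargeOp_union {X Y : Finset Λ} (h : Disjoint X Y) (κ : G →* Circle) :
    chargeOp φ (X ∪ Y) κ = ∑ κ₁ : RegionCharge φ X, ∑ κ₂ : RegionCharge φ Y,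
      if κ₁.1 * κ₂.1 = κ then chargeOp φ X κ₁.1 * chargeOp φ Y κ₂.1 else 0 := by
  have h1 : ∀ (κ₁ κ₂ : G →* Circle) (g : G),
      symOp φ (X ∪ Y) g * (chargeOp φ X κ₁ * chargeOp φ Y κ₂) =
        ((κ₁ * κ₂) g : ℂ) • (chargeOp φ X κ₁ * chargeOp φ Y κ₂) := by
    intro κ₁ κ₂ g
    have hc : Commute (symOp φ Y g) (chargeOp φ X κ₁) :=
      (isLocal_symOp φ Y g).commute h.symm (isLocal_chargeOp φ X κ₁)
    rw [← symOp_mul_symOp_of_disjoint φ h, mul_assoc, ← mul_assoc (symOp φ Y g), hc.eq,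
      mul_assoc (chargeOp φ X κ₁), symOp_mul_chargeOp, mul_smul_comm, mul_smul_comm, ← mul_assoc,
      symOp_mul_chargeOp, smul_mul_assoc, smul_smul]
    simp [mul_comm]
  calc chargeOp φ (X ∪ Y) κ = chargeOp φ (X ∪ Y) κ *
        ((∑ κ₁ : RegionCharge φ X, chargeOp φ X κ₁.1) *
          ∑ κ₂ : RegionCharge φ Y, chargeOp φ Y κ₂.1) := by
        rw [sum_chargeOp, sum_chargeOp, mul_one, mul_one]
    _ = _ := by
        rw [Finset.sum_mul_sum, Finset.mul_sum]
        refine Finset.sum_congr rfl fun κ₁ _ => ?_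
        rw [Finset.mul_sum]
        refine Finset.sum_congr rfl fun κ₂ _ => ?_
        split_ifs with hκ
        · exact chargeOp_mul_eq_self φ (hκ ▸ h1 κ₁.1 κ₂.1)
        · exact chargeOp_mul_eq_zero φ (Ne.symm hκ) (h1 κ₁.1 κ₂.1)

end Charges

/-! ### Circuits and their light cones -/

section Circuits

variable {Λ : Type u} [Fintype Λ] [DecidableEq Λ] {S : Λ → Type u} [∀ x, Fintype (S x)]
  [∀ x, DecidableEq (S x)] {G : Type u} [CommGroup G]
  {φ : ∀ x, G →* Matrix.unitaryGroup (S x) ℂ}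

/-- The unitary of the whole system implemented by a gate. -/
def SymmetricGate.toOp (a : SymmetricGate φ) : Op S := localOp a.support a.op

lemma SymmetricGate.isLocal_toOp (a : SymmetricGate φ) : IsLocal a.support a.toOp := ⟨_, rfl⟩

lemma SymmetricGate.toOp_mem (a : SymmetricGate φ) :
    a.toOp ∈ Matrix.unitaryGroup (∀ x, S x) ℂ := by
  rw [Matrix.mem_unitaryGroup_iff', Matrix.star_eq_conjTranspose, SymmetricGate.toOp,
    ← localOp_conjTranspose, ← localOp_mul, ← Matrix.star_eq_conjTranspose,
    Matrix.mem_unitaryGroup_iff'.1 a.unitary, localOp_one]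

lemma SymmetricGate.commute_toOp_symOp (a : SymmetricGate φ) (g : G) :
    Commute a.toOp (symOp φ Finset.univ g) := by
  have h : Disjoint a.support a.supportᶜ := disjoint_compl_right
  rw [← Finset.union_compl a.support, ← symOp_mul_symOp_of_disjoint φ h]
  refine Commute.mul_right ?_ (a.isLocal_toOp.commute h (isLocal_symOp φ _ g))
  rw [Commute, SemiconjBy, SymmetricGate.toOp, symOp, ← localOp_mul, ← localOp_mul, a.symmetric]

lemma SymmetricLayer.toOp_eq (U : SymmetricLayer φ) :
    U.toOp = (U.gates.map SymmetricGate.toOp).prod := rfl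

lemma SymmetricLayer.toOp_mem (U : SymmetricLayer φ) :
    U.toOp ∈ Matrix.unitaryGroup (∀ x, S x) ℂ := by
  rw [U.toOp_eq]
  refine Submonoid.list_prod_mem _ fun M hM => ?_
  obtain ⟨a, -, rfl⟩ := List.mem_map.1 hM
  exact a.toOp_mem

lemma SymmetricLayer.commute_toOp_symOp (U : SymmetricLayer φ) (g : G) :
    Commute U.toOp (symOp φ Finset.univ g) := by
  rw [U.toOp_eq]
  refine Commute.list_prod_left _ _ fun M hM => ?_
  obtain ⟨a, -, rfl⟩ := List.mem_map.1 hM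
  exact a.commute_toOp_symOp g

lemma circuitOp_cons (U : SymmetricLayer φ) (V : List (SymmetricLayer φ)) :
    circuitOp (U :: V) = U.toOp * circuitOp V := by
  simp [circuitOp]

lemma circuitOp_mem (V : List (SymmetricLayer φ)) :
    circuitOp V ∈ Matrix.unitaryGroup (∀ x, S x) ℂ := by
  refine Submonoid.list_prod_mem _ fun M hM => ?_
  obtain ⟨a, -, rfl⟩ := List.mem_map.1 hM
  exact a.toOp_mem

lemma commute_circuitOp_symOp (V : List (SymmetricLayer φ)) (g : G) :
    Commute (circuitOp V) (symOp φ Finset.univ g) := by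
  refine Commute.list_prod_left _ _ fun M hM => ?_
  obtain ⟨a, -, rfl⟩ := List.mem_map.1 hM
  exact a.commute_toOp_symOp g

/-- What commutes with a unitary commutes with its adjoint. -/
lemma commute_conjTranspose_of_mem_unitaryGroup {n : Type*} [Fintype n] [DecidableEq n]
    {U M : Matrix n n ℂ} (hU : U ∈ Matrix.unitaryGroup n ℂ) (h : Commute U M) : Commute Uᴴ M := by
  have h1 : Uᴴ * U = 1 := Matrix.mem_unitaryGroup_iff'.1 hU
  have h2 : U * Uᴴ = 1 := Matrix.mem_unitaryGroup_iff.1 hU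
  calc Uᴴ * M = Uᴴ * (M * U) * Uᴴ := by simp only [mul_assoc, h2, mul_one]
    _ = M * Uᴴ := by rw [← h.eq, ← mul_assoc, h1, one_mul]

/-- A gate overlapping the support of `T` spreads it over the support of the gate; the other gates
of the layer drop out. -/
lemma isLocal_conj_gates {l : List (SymmetricGate φ)}
    (hl : l.Pairwise fun a b => Disjoint a.support b.support) {X Y : Finset Λ} (hXY : X ⊆ Y)
    (h : ∀ a ∈ l, ¬ Disjoint a.support X → a.support ⊆ Y) {T : Op S} (hT : IsLocal X T) :
    IsLocal Y ((l.map SymmetricGate.toOp).prodᴴ * T * (l.map SymmetricGate.toOp).prod) := by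
  induction l generalizing X T with
  | nil => simpa using hT.mono hXY
  | cons a l ih =>
    rw [List.pairwise_cons] at hl
    rw [List.map_cons, List.prod_cons]
    set P := (l.map SymmetricGate.toOp).prod
    have e : (a.toOp * P)ᴴ * T * (a.toOp * P) = Pᴴ * (a.toOpᴴ * T * a.toOp) * P := by
      simp only [Matrix.conjTranspose_mul, mul_assoc]
    rw [e]
    by_cases ha : Disjoint a.support X
    · have h1 : a.toOpᴴ * T * a.toOp = T := by
        rw [mul_assoc, ← (a.isLocal_toOp.commute ha hT).eq, ← mul_assoc,
          ← Matrix.star_eq_conjTranspose, Matrix.mem_unitaryGroup_iff'.1 a.toOp_mem, one_mul]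
      rw [h1]
      exact ih hl.2 hXY (fun b hb => h b (List.mem_cons_of_mem _ hb)) hT
    · refine ih hl.2 (Finset.union_subset hXY (h a List.mem_cons_self ha)) (fun b hb hbX => ?_)
        (((a.isLocal_toOp.conjTranspose.mono Finset.subset_union_right).mul
          (hT.mono Finset.subset_union_left)).mul (a.isLocal_toOp.mono Finset.subset_union_right))
      refine h b (List.mem_cons_of_mem _ hb) fun hd => hbX ?_
      exact Finset.disjoint_union_right.2 ⟨hd, (hl.1 b hb).symm⟩

open Classical in
/-- The sites at distance at most `m` from the region `X`. -/
noncomputable def nbhd (L : SimpleGraph Λ) (X : Finset Λ) (m : ℕ) : Finset Λ :=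
  Finset.univ.filter fun x => ∃ z ∈ X, L.edist z x ≤ m

lemma mem_nbhd {L : SimpleGraph Λ} {X : Finset Λ} {m : ℕ} {x : Λ} :
    x ∈ nbhd L X m ↔ ∃ z ∈ X, L.edist z x ≤ m := by
  simp [nbhd]

lemma nbhd_mono (L : SimpleGraph Λ) (X : Finset Λ) {m m' : ℕ} (h : m ≤ m') :
    nbhd L X m ⊆ nbhd L X m' := fun x hx => by
  obtain ⟨z, hz, hzx⟩ := mem_nbhd.1 hx
  exact mem_nbhd.2 ⟨z, hz, hzx.trans (by exact_mod_cast h)⟩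

lemma subset_nbhd (L : SimpleGraph Λ) (X : Finset Λ) (m : ℕ) : X ⊆ nbhd L X m := fun x hx =>
  mem_nbhd.2 ⟨x, hx, by simp⟩

lemma isLocal_conj_layer {L : SimpleGraph Λ} {r : ℕ} (U : SymmetricLayer φ)
    (hU : ∀ a ∈ U.gates, ∀ x ∈ a.support, ∀ y ∈ a.support, L.edist x y ≤ r) {X : Finset Λ} {m : ℕ}
    {T : Op S} (hT : IsLocal (nbhd L X m) T) :
    IsLocal (nbhd L X (m + r)) (U.toOpᴴ * T * U.toOp) := by
  refine isLocal_conj_gates U.disjoint (nbhd_mono L X (Nat.le_add_right m r))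
    (fun a ha hd y hy => ?_) hT
  obtain ⟨x, hxa, hx⟩ := Finset.not_disjoint_iff.1 hd
  obtain ⟨z, hz, hzx⟩ := mem_nbhd.1 hx
  refine mem_nbhd.2 ⟨z, hz, (L.edist_triangle (v := x)).trans ?_⟩
  push_cast
  exact add_le_add hzx (hU a ha x hxa y hy)

/-- The light cone: a circuit of depth `n` spreads the support of an operator by at most `n r`. -/
lemma isLocal_conj_circuit {L : SimpleGraph Λ} {r : ℕ} (V : List (SymmetricLayer φ))
    (hV : ∀ U ∈ V, ∀ a ∈ U.gates, ∀ x ∈ a.support, ∀ y ∈ a.support, L.edist x y ≤ r)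
    {X : Finset Λ} {m : ℕ} {T : Op S} (hT : IsLocal (nbhd L X m) T) :
    IsLocal (nbhd L X (m + V.length * r)) ((circuitOp V)ᴴ * T * circuitOp V) := by
  induction V generalizing m T with
  | nil => simpa [circuitOp] using hT
  | cons U V ih =>
    have h := ih (fun U' h => hV U' (List.mem_cons_of_mem _ h))
      (isLocal_conj_layer U (hV U List.mem_cons_self) hT)
    have e1 : m + r + V.length * r = m + (U :: V).length * r := by
      rw [List.length_cons]; ring
    have e2 : (circuitOp (U :: V))ᴴ * T * circuitOp (U :: V) =
        (circuitOp V)ᴴ * (U.toOpᴴ * T * U.toOp) * circuitOp V := by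
      simp only [circuitOp_cons, Matrix.conjTranspose_mul, mul_assoc]
    rwa [e2, ← e1]

/-! ### Cutting a circuit along a region -/

/-- The layer without the gates which connect the region `D` with its complement. -/
def SymmetricLayer.cut (D : Finset Λ) (U : SymmetricLayer φ) : SymmetricLayer φ where
  gates := U.gates.filter fun a => a.support ⊆ D ∨ Disjoint a.support D
  disjoint := U.disjoint.filter _

/-- The circuit without the gates which connect the region `D` with its complement. -/
def cutCircuit (D : Finset Λ) (V : List (SymmetricLayer φ)) : List (SymmetricLayer φ) :=
  V.map (SymmetricLayer.cut D)

lemma prod_map_eq_filter_mul {α M : Type*} [Monoid M] (f : α → M) (p : α → Bool) (l : List α)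
    (hl : l.Pairwise fun a b => Commute (f a) (f b)) :
    (l.map f).prod = ((l.filter p).map f).prod * ((l.filter fun a => !p a).map f).prod := by
  induction l with
  | nil => simp
  | cons a l ih =>
    rw [List.pairwise_cons] at hl
    have hc : Commute (f a) ((l.filter p).map f).prod :=
      Commute.list_prod_right _ _ fun m hm => by
        obtain ⟨b, hb, rfl⟩ := List.mem_map.1 hm
        exact hl.1 b (List.mem_of_mem_filter hb)
    cases h : p a
    · simp [h, ih hl.2, ← mul_assoc, hc.eq]
    · simp [h, ih hl.2, mul_assoc]

/-- Pulled back through the circuits, the removed gates are symmetric operators localized near the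
gates themselves. An operator commuting with all such operators cannot distinguish the circuit from
the cut one. -/
lemma commute_circuitOp_cutCircuit {L : SimpleGraph Λ} {r n : ℕ} {D : Finset Λ}
    (V : List (SymmetricLayer φ)) (hn : V.length ≤ n + 1)
    (hV : ∀ U ∈ V, ∀ a ∈ U.gates, ∀ x ∈ a.support, ∀ y ∈ a.support, L.edist x y ≤ r) {O : Op S}
    (hO : ∀ U ∈ V, ∀ a ∈ U.gates, ¬ (a.support ⊆ D ∨ Disjoint a.support D) → ∀ K : Op S,
      IsLocal (nbhd L a.support (n * r)) K → (∀ g, Commute K (symOp φ Finset.univ g)) →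
      Commute K O) :
    Commute ((circuitOp V)ᴴ * circuitOp (cutCircuit D V)) O := by
  induction V with
  | nil => simp [circuitOp, cutCircuit]
  | cons U V ih =>
    have ih' := ih (by simp at hn; omega) (fun U' h => hV U' (List.mem_cons_of_mem _ h))
      fun U' h => hO U' (List.mem_cons_of_mem _ h)
    set W := circuitOp (cutCircuit D V) with hW
    set Z := ((U.gates.filter fun a => !decide (a.support ⊆ D ∨ Disjoint a.support D)).map
      SymmetricGate.toOp).prod with hZ
    have hWu : W ∈ Matrix.unitaryGroup (∀ x, S x) ℂ := circuitOp_mem _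
    have hWW : W * Wᴴ = 1 := Matrix.mem_unitaryGroup_iff.1 hWu
    have hWW' : Wᴴ * W = 1 := Matrix.mem_unitaryGroup_iff'.1 hWu
    have hU : U.toOp = (U.cut D).toOp * Z := by
      rw [U.toOp_eq, prod_map_eq_filter_mul _ (fun a => decide (a.support ⊆ D ∨
        Disjoint a.support D)) _ (U.disjoint.imp fun {a b} h =>
          a.isLocal_toOp.commute h b.isLocal_toOp)]
      rfl
    have hUU : U.toOpᴴ * (U.cut D).toOp = Zᴴ := by
      rw [hU, Matrix.conjTranspose_mul, mul_assoc, ← Matrix.star_eq_conjTranspose (U.cut D).toOp,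
        Matrix.mem_unitaryGroup_iff'.1 (U.cut D).toOp_mem, mul_one]
    have hcirc : (circuitOp (U :: V))ᴴ * circuitOp (cutCircuit D (U :: V)) =
        (circuitOp V)ᴴ * W * (Wᴴ * Zᴴ * W) := by
      calc _ = (circuitOp V)ᴴ * (U.toOpᴴ * (U.cut D).toOp) * W := by
            rw [cutCircuit, List.map_cons, circuitOp_cons, circuitOp_cons,
              Matrix.conjTranspose_mul]
            simp only [mul_assoc, hW, cutCircuit]
        _ = (circuitOp V)ᴴ * (W * Wᴴ) * Zᴴ * W := by rw [hUU, hWW, mul_one]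
        _ = _ := by simp only [mul_assoc]
    rw [hcirc]
    refine ih'.mul_left ?_
    have hZu : Z ∈ Matrix.unitaryGroup (∀ x, S x) ℂ := by
      refine Submonoid.list_prod_mem _ fun M hM => ?_
      obtain ⟨a, -, rfl⟩ := List.mem_map.1 hM
      exact a.toOp_mem
    have hconj : ∀ M : Op S, Commute (Wᴴ * M * W) O ↔ Commute M (W * O * Wᴴ) := by
      intro M
      constructor
      · intro h
        have := congrArg (fun X => W * X * Wᴴ) h.eq
        simp only [← mul_assoc, hWW, one_mul] at this
        rw [Commute, SemiconjBy]
        simp only [← mul_assoc]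
        rw [this, mul_assoc _ W, hWW, mul_one]
      · intro h
        have := congrArg (fun X => Wᴴ * X * W) h.eq
        simp only [← mul_assoc, hWW', one_mul] at this
        rw [Commute, SemiconjBy]
        simp only [← mul_assoc]
        rw [← this, mul_assoc _ Wᴴ, hWW', mul_one]
    rw [hconj]
    refine commute_conjTranspose_of_mem_unitaryGroup hZu (Commute.list_prod_left _ _ fun M hM => ?_)
    obtain ⟨a, ha, rfl⟩ := List.mem_map.1 hM
    have haU := List.mem_of_mem_filter ha
    rw [← hconj]
    refine hO U List.mem_cons_self a haU (by simpa using List.of_mem_filter ha) _ ?_ fun g => ?_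
    · have h0 : IsLocal (nbhd L a.support 0) a.toOp := a.isLocal_toOp.mono (subset_nbhd _ _ _)
      have hcut : ∀ U' ∈ cutCircuit D V, ∀ b ∈ U'.gates, ∀ x ∈ b.support, ∀ y ∈ b.support,
          L.edist x y ≤ r := by
        intro U' hU' b hb
        obtain ⟨U'', hU'', rfl⟩ := List.mem_map.1 hU'
        exact hV U'' (List.mem_cons_of_mem _ hU'') b (List.mem_of_mem_filter hb)
      refine (isLocal_conj_circuit _ hcut h0).mono (nbhd_mono _ _ ?_)
      simp only [List.length_cons, Nat.add_le_add_iff_right] at hn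
      simpa [cutCircuit] using Nat.mul_le_mul_right r hn
    · have hc : Commute W (symOp φ Finset.univ g) := commute_circuitOp_symOp _ g
      exact ((commute_conjTranspose_of_mem_unitaryGroup hWu hc).mul_left
        (a.commute_toOp_symOp g)).mul_left hc

/-- A unitary which is a product of a unitary of the region `D` and one of its complement. -/
def IsSplit (D : Finset Λ) (W : Op S) : Prop :=
  ∃ W₁ ∈ Matrix.unitaryGroup (∀ x, S x) ℂ, ∃ W₂ ∈ Matrix.unitaryGroup (∀ x, S x) ℂ,
    IsLocal D W₁ ∧ IsLocal Dᶜ W₂ ∧ W = W₁ * W₂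

lemma isSplit_one (D : Finset Λ) : IsSplit D (1 : Op S) :=
  ⟨1, one_mem _, 1, one_mem _, isLocal_one D, isLocal_one Dᶜ, (mul_one 1).symm⟩

lemma IsSplit.mul {D : Finset Λ} {W W' : Op S} (h : IsSplit D W) (h' : IsSplit D W') :
    IsSplit D (W * W') := by
  obtain ⟨W₁, u₁, W₂, u₂, l₁, l₂, rfl⟩ := h
  obtain ⟨W₃, u₃, W₄, u₄, l₃, l₄, rfl⟩ := h'
  refine ⟨W₁ * W₃, mul_mem u₁ u₃, W₂ * W₄, mul_mem u₂ u₄, l₁.mul l₃, l₂.mul l₄, ?_⟩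
  have hc : Commute W₂ W₃ := l₂.commute disjoint_compl_left l₃
  rw [mul_assoc, ← mul_assoc W₂, hc.eq]
  simp only [mul_assoc]

lemma isSplit_list_prod {D : Finset Λ} (l : List (Op S)) (h : ∀ W ∈ l, IsSplit D W) :
    IsSplit D l.prod := by
  induction l with
  | nil => exact isSplit_one D
  | cons W l ih =>
    rw [List.prod_cons]
    exact (h W List.mem_cons_self).mul (ih fun W' hW' => h W' (List.mem_cons_of_mem _ hW'))

lemma isSplit_cutCircuit (D : Finset Λ) (V : List (SymmetricLayer φ)) :
    IsSplit D (circuitOp (cutCircuit D V)) := by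
  refine isSplit_list_prod _ fun W hW => ?_
  obtain ⟨U', hU', rfl⟩ := List.mem_map.1 hW
  obtain ⟨U, -, rfl⟩ := List.mem_map.1 hU'
  refine isSplit_list_prod _ fun W hW => ?_
  obtain ⟨a, ha, rfl⟩ := List.mem_map.1 hW
  have h := List.of_mem_filter ha
  simp only [decide_eq_true_eq] at h
  rcases h with h | h
  · exact ⟨a.toOp, a.toOp_mem, 1, one_mem _, a.isLocal_toOp.mono h, isLocal_one _,
      (mul_one _).symm⟩
  · refine ⟨1, one_mem _, a.toOp, a.toOp_mem, isLocal_one _, a.isLocal_toOp.mono ?_,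
      (one_mul _).symm⟩
    exact le_compl_iff_disjoint_right.2 h

/-- Rotating a product state by a split unitary leaves the region and its complement
uncorrelated. -/
lemma IsProductState.trace_mul_conj {σ W : Op S} (hσ : IsProductState σ) {D : Finset Λ}
    (hW : IsSplit D W) {F H : Op S} (hF : IsLocal D F) (hH : IsLocal Dᶜ H) :
    (F * H * (Wᴴ * σ * W)).trace =
      (F * (Wᴴ * σ * W)).trace * (H * (Wᴴ * σ * W)).trace := by
  obtain ⟨W₁, u₁, W₂, u₂, l₁, l₂, rfl⟩ := hW
  have h1 : W₁ * W₁ᴴ = 1 := Matrix.mem_unitaryGroup_iff.1 u₁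
  have h2 : W₂ * W₂ᴴ = 1 := Matrix.mem_unitaryGroup_iff.1 u₂
  have key : ∀ F H : Op S, IsLocal D F → IsLocal Dᶜ H →
      (F * H * ((W₁ * W₂)ᴴ * σ * (W₁ * W₂))).trace =
        (W₁ * F * W₁ᴴ * (W₂ * H * W₂ᴴ) * σ).trace := by
    intro F H hF hH
    have c1 : Commute W₂ F := l₂.commute disjoint_compl_left hF
    have c2 : Commute W₁ᴴ W₂ := l₁.conjTranspose.commute disjoint_compl_right l₂
    have c3 : Commute W₁ᴴ H := l₁.conjTranspose.commute disjoint_compl_right hH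
    have c4 : Commute W₁ᴴ W₂ᴴ :=
      l₁.conjTranspose.commute disjoint_compl_right l₂.conjTranspose
    have e : W₁ * F * W₁ᴴ * (W₂ * H * W₂ᴴ) = (W₁ * W₂) * (F * H) * (W₁ * W₂)ᴴ := by
      calc W₁ * F * W₁ᴴ * (W₂ * H * W₂ᴴ) = W₁ * F * (W₁ᴴ * W₂) * H * W₂ᴴ := by
            simp only [mul_assoc]
        _ = W₁ * (F * W₂) * (W₁ᴴ * H) * W₂ᴴ := by rw [c2.eq]; simp only [mul_assoc]
        _ = W₁ * (W₂ * F) * H * (W₁ᴴ * W₂ᴴ) := by rw [c3.eq, ← c1.eq]; simp only [mul_assoc]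
        _ = _ := by rw [c4.eq, Matrix.conjTranspose_mul]; simp only [mul_assoc]
    rw [e, Matrix.trace_mul_comm (F * H), mul_assoc _ (W₁ * W₂) (F * H), Matrix.trace_mul_comm,
      ← mul_assoc, Matrix.trace_mul_comm, Matrix.trace_mul_comm]
  have kF := key F 1 hF (isLocal_one _)
  have kH := key 1 H (isLocal_one _) hH
  simp only [mul_one, one_mul, h1, h2] at kF kH
  rw [key F H hF hH, kF, kH]
  exact hσ.trace_mul ((l₁.mul hF).mul l₁.conjTranspose) ((l₂.mul hH).mul l₂.conjTranspose)

end Circuits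

/-! ### Separable states carry no entanglement -/

section Separability

variable {m n : Type u} [Fintype m] [Fintype n]

lemma isState_inv_trace_smul {A : Matrix m m ℂ} (hA : A.PosSemidef) (h : A.trace ≠ 0) :
    IsState (A.trace⁻¹ • A) := by
  refine ⟨hA.smul (inv_nonneg.2 hA.trace_nonneg), ?_⟩
  rw [Matrix.trace_smul, smul_eq_mul, inv_mul_cancel₀ h]

/-- Separability up to normalization of the terms. -/
lemma isSeparable_of_eq_sum {ι : Type*} [Fintype ι] {ω : Matrix (m × n) (m × n) ℂ}
    (σ : ι → Matrix m m ℂ) (τ : ι → Matrix n n ℂ) (hσ : ∀ i, (σ i).PosSemidef)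
    (hτ : ∀ i, (τ i).PosSemidef) (hω : ω = ∑ i, σ i ⊗ₖ τ i) (htr : ω.trace = 1) :
    IsSeparable ω := by
  have hsum : ∑ i, (σ i).trace * (τ i).trace = 1 := by
    rw [← htr, hω, Matrix.trace_sum]
    exact Finset.sum_congr rfl fun i _ => (Matrix.trace_kronecker _ _).symm
  obtain ⟨i₀, -, hi₀⟩ : ∃ i ∈ Finset.univ, (σ i).trace * (τ i).trace ≠ 0 :=
    Finset.exists_ne_zero_of_sum_ne_zero (by rw [hsum]; exact one_ne_zero)
  -- terms of trace zero vanish; they get weight zero and an arbitrary pair of states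
  let j : ι → ι := fun i => if (σ i).trace * (τ i).trace = 0 then i₀ else i
  have hj : ∀ i, (σ (j i)).trace * (τ (j i)).trace ≠ 0 := by
    intro i
    by_cases h : (σ i).trace * (τ i).trace = 0
    · simp only [j, if_pos h]; exact hi₀
    · simp only [j, if_neg h]; exact h
  have hp : ∀ i, 0 ≤ (σ i).trace * (τ i).trace := fun i =>
    mul_nonneg (hσ i).trace_nonneg (hτ i).trace_nonneg
  have hre : ∀ i, ((((σ i).trace * (τ i).trace).re : ℝ) : ℂ) = (σ i).trace * (τ i).trace :=
    fun i => (Complex.eq_re_of_ofReal_le (r := 0) (by simpa using hp i)).symm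
  let e := Fintype.equivFin ι
  refine ⟨Fintype.card ι, fun k => ((σ (e.symm k)).trace * (τ (e.symm k)).trace).re,
    fun k => (σ (j (e.symm k))).trace⁻¹ • σ (j (e.symm k)),
    fun k => (τ (j (e.symm k))).trace⁻¹ • τ (j (e.symm k)),
    fun k => (Complex.nonneg_iff.1 (hp _)).1, ?_,
    fun k => isState_inv_trace_smul (hσ _) (left_ne_zero_of_mul (hj _)),
    fun k => isState_inv_trace_smul (hτ _) (right_ne_zero_of_mul (hj _)), ?_⟩
  · rw [Equiv.sum_comp e.symm fun i => ((σ i).trace * (τ i).trace).re, ← Complex.re_sum, hsum,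
      Complex.one_re]
  · simp only [hre]
    rw [Equiv.sum_comp e.symm fun i => ((σ i).trace * (τ i).trace) •
      (((σ (j i)).trace⁻¹ • σ (j i)) ⊗ₖ ((τ (j i)).trace⁻¹ • τ (j i))), hω]
    refine Finset.sum_congr rfl fun i _ => ?_
    by_cases h : (σ i).trace * (τ i).trace = 0
    · rw [h, zero_smul]
      rcases mul_eq_zero.1 h with h | h
      · rw [(hσ i).trace_eq_zero_iff.1 h, Matrix.zero_kronecker]
      · rw [(hτ i).trace_eq_zero_iff.1 h, Matrix.kronecker_zero]
    · have h1 : j i = i := if_neg h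
      rw [h1, Matrix.smul_kronecker, Matrix.kronecker_smul, smul_smul, smul_smul,
        mul_assoc, ← mul_inv, mul_inv_cancel₀ h, one_smul]

lemma IsSeparable.isState {ω : Matrix (m × n) (m × n) ℂ} (h : IsSeparable ω) : IsState ω := by
  obtain ⟨k, p, σ, τ, hp, hp1, hσ, hτ, rfl⟩ := h
  refine ⟨Matrix.posSemidef_sum _ fun i _ =>
    ((hσ i).1.kronecker (hτ i).1).smul (by exact_mod_cast hp i), ?_⟩
  simp only [Matrix.trace_sum, Matrix.trace_smul, Matrix.trace_kronecker, (hσ _).2, (hτ _).2,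
    mul_one, smul_eq_mul]
  exact_mod_cast hp1

open scoped MatrixOrder in
lemma exists_eq_conjTranspose_mul_self {A : Matrix m m ℂ} (hA : A.PosSemidef) :
    ∃ N : Matrix m m ℂ, A = Nᴴ * N := by
  classical
  exact CStarAlgebra.nonneg_iff_eq_star_mul_self.1 hA.nonneg

/-- A state is prepared from nothing by a channel, whose Kraus operators are the columns of a
square root of the state. -/
lemma IsState.exists_kraus {σ : Matrix m m ℂ} (hσ : IsState σ) :
    ∃ v : m → Matrix m PUnit.{u + 1} ℂ, ∑ j, v j * (v j)ᴴ = σ ∧ ∑ j, (v j)ᴴ * v j = 1 := by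
  classical
  obtain ⟨N, rfl⟩ := exists_eq_conjTranspose_mul_self hσ.1
  have h1 := hσ.2
  refine ⟨fun j => Matrix.of fun a _ => star (N j a), ?_, ?_⟩
  · ext a b
    simp [Matrix.sum_apply, Matrix.mul_apply]
  · ext a b
    rw [Matrix.trace] at h1
    simp only [Matrix.diag_apply, Matrix.mul_apply, Matrix.conjTranspose_apply] at h1
    rw [Finset.sum_comm] at h1
    simpa [Matrix.sum_apply, Matrix.mul_apply, mul_comm] using h1

/-- A separable state can be prepared by one round of LOCC from the trivial product state: one
party draws a term of the mixture and announces it, and both prepare their states. -/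
lemma IsSeparable.loccLeftToRight {ω : Matrix (m × n) (m × n) ℂ} (h : IsSeparable ω) :
    LOCCLeftToRight ((1 : Matrix PUnit.{u + 1} PUnit.{u + 1} ℂ) ⊗ₖ
      (1 : Matrix PUnit.{u + 1} PUnit.{u + 1} ℂ)) ω := by
  obtain ⟨k, p, σ, τ, hp, hp1, hσ, hτ, rfl⟩ := h
  choose v hv hv1 using fun i => (hσ i).exists_kraus
  choose w hw hw1 using fun i => (hτ i).exists_kraus
  let e := (Fintype.equivFin (Fin k × m)).symm
  let f := (Fintype.equivFin n).symm
  have hs : ∀ i, ((Real.sqrt (p i) : ℝ) : ℂ) * star ((Real.sqrt (p i) : ℝ) : ℂ) = (p i : ℂ) := by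
    intro i
    rw [Complex.star_def, Complex.conj_ofReal, ← Complex.ofReal_mul, Real.mul_self_sqrt (hp i)]
  refine ⟨_, _, fun x => ((Real.sqrt (p (e x).1) : ℝ) : ℂ) • v (e x).1 (e x).2,
    fun x l => w (e x).1 (f l), ?_, fun x => ?_, ?_⟩
  · rw [Equiv.sum_comp e fun y => (((Real.sqrt (p y.1) : ℝ) : ℂ) • v y.1 y.2)ᴴ *
      (((Real.sqrt (p y.1) : ℝ) : ℂ) • v y.1 y.2), Fintype.sum_prod_type]
    simp only [Matrix.conjTranspose_smul, Matrix.smul_mul, Matrix.mul_smul, smul_smul, hs,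
      ← Finset.smul_sum, hv1, ← Finset.sum_smul]
    rw [← Complex.ofReal_sum, hp1, Complex.ofReal_one, one_smul]
  · rw [Equiv.sum_comp f fun l => (w (e x).1 l)ᴴ * w (e x).1 l, hw1]
  · have h1 : ∀ x, ∑ l, ((((Real.sqrt (p (e x).1) : ℝ) : ℂ) • v (e x).1 (e x).2) ⊗ₖ
        w (e x).1 (f l)) * ((1 : Matrix PUnit.{u + 1} PUnit.{u + 1} ℂ) ⊗ₖ
          (1 : Matrix PUnit.{u + 1} PUnit.{u + 1} ℂ)) *
        ((((Real.sqrt (p (e x).1) : ℝ) : ℂ) • v (e x).1 (e x).2) ⊗ₖ w (e x).1 (f l))ᴴ =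
        (p (e x).1 : ℂ) • ((v (e x).1 (e x).2 * (v (e x).1 (e x).2)ᴴ) ⊗ₖ τ (e x).1) := by
      intro x
      rw [← hw, Equiv.sum_comp f fun l => ((((Real.sqrt (p (e x).1) : ℝ) : ℂ) •
        v (e x).1 (e x).2) ⊗ₖ w (e x).1 l) * ((1 : Matrix PUnit.{u + 1} PUnit.{u + 1} ℂ) ⊗ₖ
          (1 : Matrix PUnit.{u + 1} PUnit.{u + 1} ℂ)) *
        ((((Real.sqrt (p (e x).1) : ℝ) : ℂ) • v (e x).1 (e x).2) ⊗ₖ w (e x).1 l)ᴴ]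
      have hk : ∀ (M : Matrix m m ℂ) (N : n → Matrix n n ℂ),
          M ⊗ₖ (∑ l, N l) = ∑ l, M ⊗ₖ N l := by
        intro M N
        ext a b
        simp [Matrix.kroneckerMap_apply, Matrix.sum_apply, Finset.mul_sum]
      rw [hk, Finset.smul_sum]
      refine Finset.sum_congr rfl fun l _ => ?_
      rw [Matrix.conjTranspose_kronecker, ← Matrix.mul_kronecker_mul, ← Matrix.mul_kronecker_mul,
        Matrix.mul_one, Matrix.mul_one, Matrix.conjTranspose_smul, Matrix.smul_mul, Matrix.mul_smul, smul_smul,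
        hs, Matrix.smul_kronecker]
    simp only [h1]
    rw [Equiv.sum_comp e fun y => (p y.1 : ℂ) • ((v y.1 y.2 * (v y.1 y.2)ᴴ) ⊗ₖ τ y.1),
      Fintype.sum_prod_type]
    refine Finset.sum_congr rfl fun i _ => ?_
    rw [← hv]
    ext a b
    simp [Matrix.kroneckerMap_apply, Matrix.sum_apply, Finset.sum_mul, Finset.mul_sum]

theorem EntanglementMeasure.value_eq_zero (E : EntanglementMeasure.{u})
    {ω : Matrix (m × n) (m × n) ℂ} (h : IsSeparable ω) : E.value m n ω = 0 := by
  have h1 : IsState (1 : Matrix PUnit.{u + 1} PUnit.{u + 1} ℂ) :=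
    ⟨Matrix.PosSemidef.one, by simp⟩
  have h2 : IsState ((1 : Matrix PUnit.{u + 1} PUnit.{u + 1} ℂ) ⊗ₖ
      (1 : Matrix PUnit.{u + 1} PUnit.{u + 1} ℂ)) :=
    ⟨h1.1.kronecker h1.1, by simp⟩
  refine le_antisymm ?_ (E.nonneg m n ω h.isState)
  rw [← E.product PUnit PUnit _ _ h1 h1]
  exact E.le_of_leftToRight _ _ _ _ _ _ h2 h.loccLeftToRight

end Separability

/-! ### Geometry of the cut -/

section Geometry

variable {Λ : Type u} {L : SimpleGraph Λ}

lemma edist_le_add {x y z : Λ} {m k : ℕ} (h : L.edist x y ≤ m) (h' : L.edist y z ≤ k) :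
    L.edist x z ≤ (m + k : ℕ) := by
  push_cast
  exact (L.edist_triangle (v := y)).trans (add_le_add h h')

/-- A walk leaving `C` passes through `A` or `B`. -/
lemma exists_mem_union_of_walk [DecidableEq Λ] {A B C : Finset Λ} (hC : IsSurrounded L A B C)
    {p q : Λ} (w : L.Walk p q) (hp : p ∈ C) (hq : q ∉ C) :
    ∃ a ∈ A ∪ B, L.edist p a + L.edist a q ≤ w.length := by
  induction w with
  | nil => exact absurd hp hq
  | @cons p v q h w ih =>
    have h1 : L.edist p v ≤ 1 := (SimpleGraph.edist_eq_one_iff_adj.2 h).le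
    by_cases hv : v ∈ C
    · obtain ⟨a, ha, hle⟩ := ih hv hq
      refine ⟨a, ha, ?_⟩
      calc L.edist p a + L.edist a q ≤ (L.edist p v + L.edist v a) + L.edist a q :=
            add_le_add_left L.edist_triangle _
        _ = L.edist p v + (L.edist v a + L.edist a q) := add_assoc _ _ _
        _ ≤ 1 + w.length := add_le_add h1 hle
        _ = _ := by rw [SimpleGraph.Walk.length_cons, add_comm]; push_cast; rfl
    · have hvAB : v ∈ A ∪ B := (Finset.mem_union.1 (hC.2.2 p hp v h)).resolve_right hv
      refine ⟨v, hvAB, ?_⟩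
      calc L.edist p v + L.edist v q ≤ 1 + w.length := add_le_add h1 (L.edist_le w)
        _ = _ := by rw [SimpleGraph.Walk.length_cons, add_comm]; push_cast; rfl

variable [Fintype Λ] [DecidableEq Λ]

/-- Let a region `X` of diameter at most `r` contain sites closer to `A` than `2 R` and sites
farther away. Then the sites from which the light cone reaches `X` avoid `A` and `B`, and they do
not lie on both sides of the boundary of `C`: otherwise a path crossing this boundary would meet `A`
or `B` within distance `2 R` of `X`. -/
lemma nbhd_of_crossing {A B C X : Finset Λ} {R r n : ℕ} (hnr : (n + 1) * r ≤ R)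
    (hC : IsSurrounded L A B C) (hAB : ∀ a ∈ A, ∀ b ∈ B, ((4 * R : ℕ) : ℕ∞) < L.edist a b)
    (hX : ∀ x ∈ X, ∀ y ∈ X, L.edist x y ≤ r)
    (hcross : ¬ (X ⊆ nbhd L A (2 * R) ∨ Disjoint X (nbhd L A (2 * R)))) :
    Disjoint (nbhd L X (n * r)) A ∧ Disjoint (nbhd L X (n * r)) B ∧
      (nbhd L X (n * r) ⊆ C ∨ Disjoint (nbhd L X (n * r)) C) := by
  obtain ⟨h1, h2⟩ := not_or.1 hcross
  obtain ⟨y, hyX, hy⟩ := Finset.not_subset.1 h1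
  obtain ⟨x, hxX, hx⟩ := Finset.not_disjoint_iff.1 h2
  obtain ⟨a₀, ha₀, hax⟩ := mem_nbhd.1 hx
  -- no site of `A` or `B` is within distance `2 R` of all of `X`
  have far : ∀ a ∈ A ∪ B, ¬ ∀ z ∈ X, L.edist a z ≤ (2 * R : ℕ) := by
    intro a ha hle
    rcases Finset.mem_union.1 ha with ha | ha
    · exact hy (mem_nbhd.2 ⟨a, ha, hle y hyX⟩)
    · refine absurd (hAB a₀ ha₀ a ha) (not_lt.2 ?_)
      have := hle x hxX
      rw [SimpleGraph.edist_comm] at this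
      have := edist_le_add hax this
      rwa [← two_mul, ← mul_assoc] at this
  have near : ∀ p ∈ nbhd L X (n * r), ∀ z ∈ X, L.edist p z ≤ R := by
    intro p hp z hz
    obtain ⟨z', hz', hzp⟩ := mem_nbhd.1 hp
    rw [SimpleGraph.edist_comm] at hzp
    refine (edist_le_add hzp (hX z' hz' z hz)).trans ?_
    exact_mod_cast (by linarith : n * r + r ≤ R)
  have avoid : ∀ p ∈ nbhd L X (n * r), p ∉ A ∪ B := fun p hp hpAB =>
    far p hpAB fun z hz => (near p hp z hz).trans (by exact_mod_cast (by omega : R ≤ 2 * R))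
  refine ⟨Finset.disjoint_left.2 fun p hp hpA => avoid p hp (Finset.mem_union_left _ hpA),
    Finset.disjoint_left.2 fun p hp hpB => avoid p hp (Finset.mem_union_right _ hpB), ?_⟩
  by_contra hcon
  obtain ⟨h3, h4⟩ := not_or.1 hcon
  obtain ⟨q, hq, hqC⟩ := Finset.not_subset.1 h3
  obtain ⟨p, hp, hpC⟩ := Finset.not_disjoint_iff.1 h4
  have hpq : L.edist p q ≤ (2 * R : ℕ) := by
    have := near q hq x hxX
    rw [SimpleGraph.edist_comm] at this
    rw [two_mul]
    exact edist_le_add (near p hp x hxX) this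
  obtain ⟨w, hw⟩ := L.exists_walk_of_edist_ne_top
    (ne_top_of_le_ne_top (ENat.natCast_ne_top _) hpq)
  obtain ⟨a, ha, hle⟩ := exists_mem_union_of_walk hC w hpC hqC
  rw [hw] at hle
  have hle' := hle.trans hpq
  have hor : L.edist a p ≤ R ∨ L.edist a q ≤ R := by
    by_contra! hlt
    rw [SimpleGraph.edist_comm] at hle'
    refine absurd hle' (not_le.2 ?_)
    rw [two_mul]
    push_cast
    exact ENat.add_lt_add hlt.1 hlt.2
  refine far a ha fun z hz => ?_
  rw [two_mul]
  rcases hor with h | h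
  · exact edist_le_add h (near p hp z hz)
  · exact edist_le_add h (near q hq z hz)

end Geometry

/-! ### Reduction to an uncorrelated state -/

section Reduction

variable {Λ : Type u} [Fintype Λ] [DecidableEq Λ] {S : Λ → Type u} [∀ x, Fintype (S x)]
  [∀ x, DecidableEq (S x)] {G : Type u} [CommGroup G]
  {φ : ∀ x, G →* Matrix.unitaryGroup (S x) ℂ}

/-- A symmetric operator localized inside of `C` commutes with the symmetry of `C`, because the
symmetry of the complement of `C` does not affect it. -/
lemma commute_symOp_of_subset {C Y : Finset Λ} {K : Op S} (hK : IsLocal Y K) (hY : Y ⊆ C) (g : G)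
    (hsym : Commute K (symOp φ Finset.univ g)) : Commute K (symOp φ C g) := by
  have hd : Disjoint C Cᶜ := disjoint_compl_right
  have h1 : Commute K (symOp φ Cᶜ g) :=
    hK.commute (Finset.disjoint_of_subset_left hY hd) (isLocal_symOp φ _ g)
  have h2 : symOp φ C g = symOp φ Finset.univ g * (symOp φ Cᶜ g)ᴴ := by
    rw [← Finset.union_compl C, ← symOp_mul_symOp_of_disjoint φ hd, mul_assoc,
      symOp_mul_conjTranspose, mul_one]
  have hu : symOp φ Cᶜ g ∈ Matrix.unitaryGroup (∀ x, S x) ℂ :=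
    Matrix.mem_unitaryGroup_iff.2 (symOp_mul_conjTranspose φ _ g)
  rw [h2]
  exact hsym.mul_right (commute_conjTranspose_of_mem_unitaryGroup hu h1.symm).symm

/-- The observables of `A` and `B` and the charge of `C` have the same joint expectation values in
`ρ` and in a state without correlations between a neighbourhood of `A` and its complement. -/
theorem exists_uncorrelated_state {L : SimpleGraph Λ} {ρ : Op S} (hρ : IsState ρ) {R : ℕ}
    {V : List (SymmetricLayer φ)} (hV : CircuitRangeLE L V R)
    (hprod : IsProductState (circuitOp V * ρ * (circuitOp V)ᴴ)) {A B C : Finset Λ}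
    (hC : IsSurrounded L A B C) (hAB : ∀ a ∈ A, ∀ b ∈ B, ((4 * R : ℕ) : ℕ∞) < L.edist a b) :
    ∃ (D : Finset Λ) (ρ' : Op S), A ⊆ D ∧ B ⊆ Dᶜ ∧ IsState ρ' ∧
      (∀ F H : Op S, IsLocal D F → IsLocal Dᶜ H →
        (F * H * ρ').trace = (F * ρ').trace * (H * ρ').trace) ∧
      ∀ (κ : RegionCharge φ C) (F H : Op S), IsLocal A F → IsLocal B H →
        (F * H * (chargeOp φ C κ.1 * ρ)).trace = (F * H * chargeOp φ C κ.1 * ρ').trace := by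
  obtain ⟨r, hr, hR⟩ := hV
  set D := nbhd L A (2 * R) with hD
  set W := circuitOp (cutCircuit D V) with hW
  set T := (circuitOp V)ᴴ * W with hT
  have hVu := circuitOp_mem V
  have hWu : W ∈ Matrix.unitaryGroup (∀ x, S x) ℂ := circuitOp_mem _
  have hTu : T ∈ Matrix.unitaryGroup (∀ x, S x) ℂ := mul_mem (Unitary.star_mem hVu) hWu
  have hTT : T * Tᴴ = 1 := Matrix.mem_unitaryGroup_iff.1 hTu
  have hρ' : Tᴴ * ρ * T = Wᴴ * (circuitOp V * ρ * (circuitOp V)ᴴ) * W := by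
    simp only [hT, Matrix.conjTranspose_mul, Matrix.conjTranspose_conjTranspose, mul_assoc]
  -- `V` and `W` differ by symmetric operators localized away from `A`, `B` and the boundary of `C`
  have hcomm : ∀ O : Op S, (∀ Y : Finset Λ, Disjoint Y A → Disjoint Y B → (Y ⊆ C ∨ Disjoint Y C) →
      ∀ K : Op S, IsLocal Y K → (∀ g, Commute K (symOp φ Finset.univ g)) → Commute K O) →
      Commute T O := by
    intro O hO
    refine commute_circuitOp_cutCircuit (n := V.length - 1) V (by omega) hr
      fun U hU a ha hcross K hK hsym => ?_
    have hlen : 0 < V.length := List.length_pos_of_mem hU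
    obtain ⟨h1, h2, h3⟩ := nbhd_of_crossing (n := V.length - 1)
      (by rwa [Nat.sub_add_cancel hlen]) hC hAB (hr U hU a ha) hcross
    exact hO _ h1 h2 h3 K hK hsym
  have hTA : ∀ F : Op S, IsLocal A F → Commute T F := fun F hF =>
    hcomm F fun Y h1 _ _ K hK _ => hK.commute h1 hF
  have hTB : ∀ F : Op S, IsLocal B F → Commute T F := fun F hF =>
    hcomm F fun Y _ h2 _ K hK _ => hK.commute h2 hF
  have hTC : ∀ κ : RegionCharge φ C, Commute T (chargeOp φ C κ.1) := by
    refine commute_chargeOp φ fun g => hcomm _ fun Y _ _ h3 K hK hsym => ?_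
    rcases h3 with h3 | h3
    · exact commute_symOp_of_subset hK h3 g (hsym g)
    · exact hK.commute h3 (isLocal_symOp φ C g)
  refine ⟨D, Tᴴ * ρ * T, subset_nbhd L A _, fun b hb => ?_, ⟨?_, ?_⟩, ?_, ?_⟩
  · refine Finset.mem_compl.2 fun hbD => ?_
    obtain ⟨a, ha, hab⟩ := mem_nbhd.1 hbD
    refine absurd (hAB a ha b hb) (not_lt.2 (hab.trans ?_))
    exact_mod_cast (by omega : 2 * R ≤ 4 * R)
  · exact hρ.1.conjTranspose_mul_mul_same T
  · rw [Matrix.trace_mul_comm, ← mul_assoc, hTT, one_mul, hρ.2]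
  · intro F H hF hH
    rw [hρ']
    exact hprod.trace_mul_conj (isSplit_cutCircuit D V) hF hH
  · intro κ F H hF hH
    have hc := (((hTA F hF).mul_right (hTB H hH)).mul_right (hTC κ))
    have hc' := commute_conjTranspose_of_mem_unitaryGroup hTu hc
    calc (F * H * (chargeOp φ C κ.1 * ρ)).trace
        = (F * H * chargeOp φ C κ.1 * ρ * T * Tᴴ).trace := by
          rw [mul_assoc _ T, hTT, mul_one, ← mul_assoc]
      _ = (Tᴴ * (F * H * chargeOp φ C κ.1) * ρ * T).trace := by
          rw [Matrix.trace_mul_comm]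
          simp only [mul_assoc]
      _ = (F * H * chargeOp φ C κ.1 * (Tᴴ * ρ * T)).trace := by
          rw [hc'.eq]
          simp only [mul_assoc]

end Reduction

/-! ### The separable decomposition -/

section Decomposition

variable {Λ : Type u} [Fintype Λ] [DecidableEq Λ] {S : Λ → Type u} [∀ x, Fintype (S x)]
  [∀ x, DecidableEq (S x)] {G : Type u} [CommGroup G]

/-- The state of the region `A` conditioned on the outcome `Q`, not normalized: the partial trace
of `Q ρ` over all other sites. -/
def condState (A : Finset Λ) (Q ρ : Op S) : Matrix (Conf S A) (Conf S A) ℂ :=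
  Matrix.of fun a a' => (localOp A (single a' a 1) * Q * ρ).trace

lemma posSemidef_condState {A : Finset Λ} {Q ρ : Op S} (hρ : ρ.PosSemidef) (hQ : Qᴴ = Q)
    (hQQ : Q * Q = Q) (hAQ : ∀ F, IsLocal A F → Commute F Q) : (condState A Q ρ).PosSemidef := by
  refine Matrix.PosSemidef.of_dotProduct_mulVec_nonneg ?_ fun v => ?_
  · ext a a'
    have h1 : localOp A (single a' a (1 : ℂ)) = (localOp A (single a a' 1))ᴴ := by
      rw [← localOp_conjTranspose, Matrix.conjTranspose_single, star_one]
    rw [Matrix.conjTranspose_apply, condState, Matrix.of_apply, Matrix.of_apply,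
      ← Matrix.trace_conjTranspose, Matrix.conjTranspose_mul, Matrix.conjTranspose_mul, hQ,
      hρ.isHermitian.eq, Matrix.trace_mul_comm, ← h1,
      (hAQ _ (isLocal_localOp A (single a' a 1))).eq]
  · obtain ⟨N, hN⟩ := exists_eq_conjTranspose_mul_self
      (Matrix.posSemidef_vecMulVec_self_star v)
    have h1 : star v ⬝ᵥ condState A Q ρ *ᵥ v =
        (localOp A (Matrix.vecMulVec v (star v)) * Q * ρ).trace := by
      have h2 : Matrix.vecMulVec v (star v) =
          ∑ a, ∑ a', (star (v a) * v a') • single a' a (1 : ℂ) := by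
        ext b b'
        simp [Matrix.vecMulVec_apply, Matrix.sum_apply, Matrix.single_apply, mul_comm, ite_and]
      rw [h2]
      simp only [localOp_sum, localOp_smul, Finset.sum_mul, smul_mul_assoc, Matrix.trace_sum,
        Matrix.trace_smul, dotProduct, Matrix.mulVec, condState, Matrix.of_apply, Pi.star_apply,
        Finset.mul_sum, smul_eq_mul]
      exact Finset.sum_congr rfl fun a _ => Finset.sum_congr rfl fun a' _ => by ring
    -- with `Y = N Q` the expectation value is the trace of `Y ρ Y*`
    have h3 : localOp A (Nᴴ * N) * Q = (localOp A N * Q)ᴴ * (localOp A N * Q) := by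
      rw [Matrix.conjTranspose_mul, hQ, ← localOp_conjTranspose, ← mul_assoc,
        mul_assoc Q, ← localOp_mul, ← (hAQ _ (isLocal_localOp A (Nᴴ * N))).eq, mul_assoc, hQQ]
    rw [h1, hN, h3, mul_assoc, Matrix.trace_mul_comm]
    exact (hρ.mul_mul_conjTranspose_same _).trace_nonneg

lemma sum_localOp_single (A : Finset Λ) :
    ∑ a : Conf S A, localOp A (single a a (1 : ℂ)) = 1 := by
  rw [← localOp_sum, ← localOp_one A]
  congr 1
  ext a b
  simp [Matrix.sum_apply, Matrix.single_apply, Matrix.one_apply, ite_and]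

lemma trace_traceOutside {A B : Finset Λ} (h : Disjoint A B) (M : Op S) :
    (traceOutside A B M).trace = M.trace := by
  rw [Matrix.trace, Fintype.sum_prod_type]
  simp only [Matrix.diag_apply, traceOutside_apply h, ← Matrix.trace_sum, ← Finset.sum_mul, ← Finset.mul_sum, sum_localOp_single, one_mul]

variable (φ : ∀ x, G →* Matrix.unitaryGroup (S x) ℂ)

lemma trace_Omega {A B : Finset Λ} (h : Disjoint A B) (C : Finset Λ) (ρ : Op S) :
    (Omega φ A B C ρ).trace = ρ.trace := by
  have h1 : (Omega φ A B C ρ).trace =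
      ∑ κ : RegionCharge φ C, (traceOutside A B (chargeOp φ C κ.1 * ρ)).trace := by
    simp only [Matrix.trace, Matrix.diag_apply, Omega, Matrix.of_apply, if_true,
      Fintype.sum_prod_type]
    rfl
  simp only [h1, trace_traceOutside h]
  rw [← Matrix.trace_sum, ← Finset.sum_mul, sum_chargeOp, one_mul]

lemma trace_Omega' (A B C : Finset Λ) (ρ : Op S) :
    (Omega' φ A B C ρ).trace = (Omega φ A B C ρ).trace := by
  let e : Conf S A × (RegionCharge φ C × Conf S B) ≃ (RegionCharge φ C × Conf S A) × Conf S B :=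
    { toFun := fun i => ((i.2.1, i.1), i.2.2)
      invFun := fun i => (i.1.2, (i.1.1, i.2))
      left_inv := fun _ => rfl
      right_inv := fun _ => rfl }
  exact Fintype.sum_equiv e _ _ fun i => rfl

lemma posSemidef_single {ι : Type*} [Fintype ι] [DecidableEq ι] (i : ι) :
    (single i i (1 : ℂ)).PosSemidef := by
  rw [← Matrix.diagonal_single]
  exact Matrix.PosSemidef.diagonal (Pi.single_nonneg.2 zero_le_one)

open Classical in
/-- The charge of `C` is the product of the charges of its parts inside and outside of `D`, which
are measured in uncorrelated systems. -/
lemma Omega_apply_eq_sum {A B C D : Finset Λ} (hA : A ⊆ D) (hB : B ⊆ Dᶜ) {ρ ρ' : Op S}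
    (hunc : ∀ F H : Op S, IsLocal D F → IsLocal Dᶜ H →
        (F * H * ρ').trace = (F * ρ').trace * (H * ρ').trace)
    (heq : ∀ (κ : RegionCharge φ C) (F H : Op S), IsLocal A F → IsLocal B H →
        (F * H * (chargeOp φ C κ.1 * ρ)).trace = (F * H * chargeOp φ C κ.1 * ρ').trace)
    (i j : (RegionCharge φ C × Conf S A) × Conf S B) :
    Omega φ A B C ρ i j = ∑ κ : RegionCharge φ C, ∑ κ₁ : RegionCharge φ (C ∩ D),
      ∑ κ₂ : RegionCharge φ (C \ D), if κ₁.1 * κ₂.1 = κ.1 then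
        single κ κ (1 : ℂ) i.1.1 j.1.1 * condState A (chargeOp φ (C ∩ D) κ₁.1) ρ' i.1.2 j.1.2 *
          condState B (chargeOp φ (C \ D) κ₂.1) ρ' i.2 j.2 else 0 := by
  have hAB : Disjoint A B := by
    refine Finset.disjoint_left.2 fun x hx hx' => ?_
    exact Finset.mem_compl.1 (hB hx') (hA hx)
  have hfus : ∀ κ : G →* Circle, chargeOp φ C κ = ∑ κ₁ : RegionCharge φ (C ∩ D),
      ∑ κ₂ : RegionCharge φ (C \ D), if κ₁.1 * κ₂.1 = κ then
        chargeOp φ (C ∩ D) κ₁.1 * chargeOp φ (C \ D) κ₂.1 else 0 := by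
    intro κ
    rw [← chargeOp_union φ (Finset.disjoint_sdiff_inter C D).symm, Finset.union_comm,
      Finset.sdiff_union_inter]
  have hterm : ∀ (κ₁ κ₂ : G →* Circle) (F H : Op S), IsLocal A F → IsLocal B H →
      (F * H * (chargeOp φ (C ∩ D) κ₁ * chargeOp φ (C \ D) κ₂) * ρ').trace =
        (F * chargeOp φ (C ∩ D) κ₁ * ρ').trace * (H * chargeOp φ (C \ D) κ₂ * ρ').trace := by
    intro κ₁ κ₂ F H hF hH
    have l1 : IsLocal D (chargeOp φ (C ∩ D) κ₁) :=
      (isLocal_chargeOp φ _ κ₁).mono Finset.inter_subset_right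
    have l2 : IsLocal Dᶜ (chargeOp φ (C \ D) κ₂) :=
      (isLocal_chargeOp φ _ κ₂).mono fun x hx => Finset.mem_compl.2 (Finset.mem_sdiff.1 hx).2
    have hc : Commute H (chargeOp φ (C ∩ D) κ₁) :=
      (hH.mono hB).commute disjoint_compl_left l1
    rw [← hunc _ _ ((hF.mono hA).mul l1) ((hH.mono hB).mul l2)]
    congr 2
    rw [mul_assoc F, ← mul_assoc H, hc.eq]
    simp only [mul_assoc]
  have hentry : ∀ κ : RegionCharge φ C,
      traceOutside A B (chargeOp φ C κ.1 * ρ) (i.1.2, i.2) (j.1.2, j.2) =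
      ∑ κ₁ : RegionCharge φ (C ∩ D), ∑ κ₂ : RegionCharge φ (C \ D), if κ₁.1 * κ₂.1 = κ.1 then
        condState A (chargeOp φ (C ∩ D) κ₁.1) ρ' i.1.2 j.1.2 *
          condState B (chargeOp φ (C \ D) κ₂.1) ρ' i.2 j.2 else 0 := by
    intro κ
    rw [traceOutside_apply hAB, heq κ _ _ (isLocal_localOp A _) (isLocal_localOp B _), hfus]
    simp only [Finset.mul_sum, Finset.sum_mul, Matrix.trace_sum]
    refine Finset.sum_congr rfl fun κ₁ _ => Finset.sum_congr rfl fun κ₂ _ => ?_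
    split_ifs
    · exact hterm _ _ _ _ (isLocal_localOp A _) (isLocal_localOp B _)
    · simp
  have h0 : Omega φ A B C ρ i j = if i.1.1 = j.1.1 then
      traceOutside A B (chargeOp φ C i.1.1.1 * ρ) (i.1.2, i.2) (j.1.2, j.2) else 0 := rfl
  rw [h0, Finset.sum_eq_single i.1.1]
  · split_ifs with h
    · rw [hentry]
      simp [← h]
    · simp [h]
  · intro κ _ hκ
    simp [hκ]
  · simp

end Decomposition

end SPT

theorem mainTheorem1 {Λ : Type u} [Fintype Λ] [DecidableEq Λ] (L : SimpleGraph Λ)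
    (S : Λ → Type u) [∀ x, Fintype (S x)] [∀ x, DecidableEq (S x)]
    {G : Type u} [CommGroup G] (φ : ∀ x, G →* Matrix.unitaryGroup (S x) ℂ)
    (ρ : SPT.Op S) (hρ : SPT.IsState ρ)
    (R : ℕ) (V : List (SPT.SymmetricLayer φ)) (hV : SPT.CircuitRangeLE L V R)
    (hprod : SPT.IsProductState (SPT.circuitOp V * ρ * (SPT.circuitOp V)ᴴ))
    (A B C : Finset Λ) (hC : SPT.IsSurrounded L A B C)
    (hdist : ((4 * R : ℕ) : ℕ∞) < SPT.regionDist L A B) :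
    (SPT.IsSeparable (SPT.Omega φ A B C ρ) ∧ SPT.IsSeparable (SPT.Omega' φ A B C ρ)) ∧
      ∀ E : SPT.EntanglementMeasure.{u},
        E.value (SPT.RegionCharge φ C × SPT.Conf S A) (SPT.Conf S B) (SPT.Omega φ A B C ρ) = 0 ∧
        E.value (SPT.Conf S A) (SPT.RegionCharge φ C × SPT.Conf S B)
          (SPT.Omega' φ A B C ρ) = 0 := by
  classical
  have hAB : ∀ a ∈ A, ∀ b ∈ B, ((4 * R : ℕ) : ℕ∞) < L.edist a b := fun a ha b hb =>
    hdist.trans_le ((iInf₂_le a ha).trans (iInf₂_le b hb))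
  obtain ⟨D, ρ', hA, hB, hρ', hunc, heq⟩ :=
    SPT.exists_uncorrelated_state hρ hV hprod hC hAB
  have hdisj : Disjoint A B :=
    Finset.disjoint_left.2 fun x hx hx' => Finset.mem_compl.1 (hB hx') (hA hx)
  have hX : ∀ κ : SPT.RegionCharge φ (C ∩ D),
      (SPT.condState A (SPT.chargeOp φ (C ∩ D) κ.1) ρ').PosSemidef := fun κ =>
    SPT.posSemidef_condState hρ'.1 (SPT.chargeOp_conjTranspose φ _ _)
      (SPT.chargeOp_mul_self φ _ _) fun F hF => hF.commute
        (Finset.disjoint_of_subset_right Finset.inter_subset_left hC.1.symm)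
        (SPT.isLocal_chargeOp φ _ _)
  have hY : ∀ κ : SPT.RegionCharge φ (C \ D),
      (SPT.condState B (SPT.chargeOp φ (C \ D) κ.1) ρ').PosSemidef := fun κ =>
    SPT.posSemidef_condState hρ'.1 (SPT.chargeOp_conjTranspose φ _ _)
      (SPT.chargeOp_mul_self φ _ _) fun F hF => hF.commute
        (Finset.disjoint_of_subset_right Finset.sdiff_subset hC.2.1.symm)
        (SPT.isLocal_chargeOp φ _ _)
  have htr : (SPT.Omega φ A B C ρ).trace = 1 := (SPT.trace_Omega φ hdisj C ρ).trans hρ.2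
  have hsep : SPT.IsSeparable (SPT.Omega φ A B C ρ) := by
    refine SPT.isSeparable_of_eq_sum (ι := SPT.RegionCharge φ C × SPT.RegionCharge φ (C ∩ D) ×
        SPT.RegionCharge φ (C \ D))
      (fun x => if x.2.1.1 * x.2.2.1 = x.1.1 then
        single x.1 x.1 (1 : ℂ) ⊗ₖ SPT.condState A (SPT.chargeOp φ (C ∩ D) x.2.1.1) ρ' else 0)
      (fun x => SPT.condState B (SPT.chargeOp φ (C \ D) x.2.2.1) ρ') (fun x => ?_)
      (fun x => hY _) ?_ htr
    · split_ifs
      · exact (SPT.posSemidef_single _).kronecker (hX _)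
      · exact Matrix.PosSemidef.zero
    · ext i j
      rw [SPT.Omega_apply_eq_sum φ hA hB hunc heq]
      simp only [Matrix.sum_apply, Fintype.sum_prod_type, Matrix.kroneckerMap_apply]
      refine Finset.sum_congr rfl fun κ _ => Finset.sum_congr rfl fun κ₁ _ =>
        Finset.sum_congr rfl fun κ₂ _ => ?_
      split_ifs
      · rfl
      · simp
  have hsep' : SPT.IsSeparable (SPT.Omega' φ A B C ρ) := by
    refine SPT.isSeparable_of_eq_sum (ι := SPT.RegionCharge φ C × SPT.RegionCharge φ (C ∩ D) ×
        SPT.RegionCharge φ (C \ D))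
      (fun x => SPT.condState A (SPT.chargeOp φ (C ∩ D) x.2.1.1) ρ')
      (fun x => if x.2.1.1 * x.2.2.1 = x.1.1 then
        single x.1 x.1 (1 : ℂ) ⊗ₖ SPT.condState B (SPT.chargeOp φ (C \ D) x.2.2.1) ρ' else 0)
      (fun x => hX _) (fun x => ?_) ?_ ((SPT.trace_Omega' φ A B C ρ).trans htr)
    · split_ifs
      · exact (SPT.posSemidef_single _).kronecker (hY _)
      · exact Matrix.PosSemidef.zero
    · ext i j
      rw [SPT.Omega', Matrix.submatrix_apply, SPT.Omega_apply_eq_sum φ hA hB hunc heq]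
      simp only [Matrix.sum_apply, Fintype.sum_prod_type, Matrix.kroneckerMap_apply]
      refine Finset.sum_congr rfl fun κ _ => Finset.sum_congr rfl fun κ₁ _ =>
        Finset.sum_congr rfl fun κ₂ _ => ?_
      split_ifs
      · rw [Matrix.kroneckerMap_apply]
        ring
      · simp
  exact ⟨⟨hsep, hsep'⟩, fun E => ⟨E.value_eq_zero hsep, E.value_eq_zero hsep'⟩⟩
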